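/- For an even integer $n\ge 2$, a real $0<\beta<1$ and a real $\varepsilon>0$, let $S=S_{n,\beta,\varepsilon}$ be the real matrix whose rows are indexed by the sets $u\subseteq[n]$ of odd size with $|u|\le 1+\beta/\varepsilon$, whose columns are indexed by the perfect matchings $m$ of the complete graph on $[n]$, and whose entries are \[ S_{um}=\frac{|\delta(u)\cap m|+\beta-1}{2}, \] where $\delta(u)$ is the set of edges of the complete graph on $[n]$ with exactly one endpoint in $u$. For an entrywise nonnegative matrix $A$, let $\mathrm{rk}_+(A)$ be its nonnegative rank, i.e. the least $r$ such that $A=UV$ for entrywise nonnegative matrices $U$ with $r$ columns and $V$ with $r$ rows. Theorem. There is an absolute constant $\beta_0\in(0,1)$ such that for every $0<\beta\le\beta_0$ there are constants $0<\alpha<1$ and $c'>0$, depending only on $\beta$, such that for every even integer $n\ge2$ and every real $\varepsilon$ with $\frac{c'}{n}\le\varepsilon\le1$, \[ \mathrm{rk}_+(S_{n,\beta,\varepsilon})\ \ge\ \binom{n}{\lfloor\alpha/\varepsilon\rfloor}. \] -/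

import Mathlib

/-- The nonnegative rank of a real matrix: the least `r` for which `A = U * V` with entrywise
nonnegative `U` (with `r` columns) and `V` (with `r` rows). Every nonnegative matrix with finitely
many rows has such a factorization, see `nonnegRank_isLeast`. -/
noncomputable def nonnegRank {ι κ : Type*} (A : Matrix ι κ ℝ) : ℕ :=
  sInf {r : ℕ | ∃ (U : Matrix ι (Fin r) ℝ) (V : Matrix (Fin r) κ ℝ),
    (∀ i k, 0 ≤ U i k) ∧ (∀ k j, 0 ≤ V k j) ∧ A = U * V}

/-- For an entrywise nonnegative matrix with finitely many rows, the infimum in `nonnegRank`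
is attained. -/
theorem nonnegRank_isLeast {ι κ : Type*} [Finite ι] (A : Matrix ι κ ℝ) (hA : ∀ i j, 0 ≤ A i j) :
    IsLeast {r : ℕ | ∃ (U : Matrix ι (Fin r) ℝ) (V : Matrix (Fin r) κ ℝ),
      (∀ i k, 0 ≤ U i k) ∧ (∀ k j, 0 ≤ V k j) ∧ A = U * V} (nonnegRank A) := by
  classical
  refine ⟨Nat.sInf_mem ?_, fun r hr => Nat.sInf_le hr⟩
  obtain ⟨n, ⟨e⟩⟩ := Finite.exists_equiv_fin ι
  refine ⟨n, Matrix.of fun i k => if e i = k then 1 else 0,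
    Matrix.of fun k j => A (e.symm k) j, ?_, ?_, ?_⟩
  · intro i k
    rw [Matrix.of_apply]
    split_ifs <;> norm_num
  · intro k j
    exact hA _ _
  · ext i j
    simp [Matrix.mul_apply]

/-- `δ(u)`: the edges of the complete graph on `V` with exactly one endpoint in `u`. -/
def cutEdges {V : Type*} (u : Finset V) : Set (Sym2 V) :=
  {e | ∃ a ∈ u, ∃ b ∉ u, e = s(a, b)}

/-- The odd cuts: subsets of the vertex set `Fin n` of odd size at most `1 + β / ε`. -/
abbrev OddCut (n : ℕ) (β ε : ℝ) : Type :=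
  {u : Finset (Fin n) // Odd u.card ∧ (u.card : ℝ) ≤ 1 + β / ε}

/-- The perfect matchings of the complete graph on the vertex set `Fin n`. -/
abbrev CompleteGraphPerfectMatching (n : ℕ) : Type :=
  {m : (⊤ : SimpleGraph (Fin n)).Subgraph // m.IsPerfectMatching}

/-- The matching slack matrix, with entries `(|δ(u) ∩ m| + β - 1) / 2`. -/
noncomputable def matchingSlack (n : ℕ) (β ε : ℝ) :
    Matrix (OddCut n β ε) (CompleteGraphPerfectMatching n) ℝ :=
  Matrix.of fun u m => (((cutEdges u.1 ∩ m.1.edgeSet).ncard : ℝ) + β - 1) / 2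

set_option linter.unusedSectionVars false

/-! A nonnegative factorization writes the matrix as a sum of `R` rectangles `f ⊗ g`. These are
tested against random pairs of an odd set and a perfect matching, in a Razborov-style corruption
argument.

The vertices are two copies of a set `I` of size `n / 2`. The odd set `u` lies in one copy. An
involution of `I` yields a matching: a fixed point is joined to its twin, a two-cycle is matched
inside each copy. `I` consists of three special elements, a `K × B` array of blocks of size `2q`,
and spare elements; `u` takes the special elements and one block per row, the involution acts on
every block separately, and a random permutation hides the structure. When all chosen blocks are
flipped, the trivial action on the special elements gives a pair cut three times, with entry `(2 +
β) / 2`, and a transposition gives a pair cut once, with entry `β / 2`. Call the special elements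
and one chosen block a core, of size `k = 3 + 2q`; if that block is fixed pointwise instead, the
trivial action gives the entry `(k - 1 + β) / 2`, only linear in `k`.

For `f`, `g` with values in `[0, 1]`, `massThree_le` bounds half the mass on triply cut pairs by
`O(1/k²)` times the core mass, plus a constant times the mass on pairs cut once, plus an error
exponentially small in `K log Λ`. Summed over the factorization, the core contributes `O(1/k)`,
small for `k = 63`, and the pairs cut once contribute `O(β)`. The error, multiplied by `R` and by
the largest possible entry, must supply the rest, so `R` is exponential in `K log B` when `Λ` is a
power of `B`.

Two mechanisms prove `massThree_le`. The first is entropy: as `x` is revealed and `y` averaged out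
row by row, the products of conditional means keep their average (`expect_condRows_mul_condCols`)
while the logarithms telescope (`sum_growth_le`). Unless the rectangle is tiny, sharp growth in a
row is therefore rare, and Bessel's inequality shows that conditioning on one block state then
rarely matters (`expect_not_typical_le`).

The second is combinatorial: fix a core and vary the triple `F` in it that plays the special
elements. Neither `f` nor the fully fixed core sees `F`, and for a typical triple the triply cut
mean is at most twice the core mean. If two typical triples of non-negligible weight meet in exactly
one element, the transposition of `F \ F'` is a special transposition in one view and a mere change
of a block in the other, which forces mass on pairs cut once (`expect_typical_pair_le`). Otherwise
the heavy triples form an oddtown family, so there are at most `k` of them among `choose k 3`. -/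

namespace MatchingSlack

open Finset
open scoped BigOperators

/-! ### Resampling one coordinate of a product space -/

section Expect

variable {ι β : Type*} [Fintype ι] [DecidableEq ι] [Fintype β] [Nonempty β]

/-- Averaging over a function space is unchanged by resampling one coordinate. -/
theorem expect_update (i : ι) (Φ : (ι → β) → ℝ) :
    𝔼 x, 𝔼 a, Φ (Function.update x i a) = 𝔼 x, Φ x := by
  -- Exchanging the fresh value with the old one preserves the uniform measure.
  have hinv : Function.Involutive
      (fun z : (ι → β) × β => (Function.update z.1 i z.2, z.1 i)) := by
    rintro ⟨x, a⟩
    simp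
  have h1 : 𝔼 z : (ι → β) × β, Φ (Function.update z.1 i z.2) = 𝔼 z : (ι → β) × β, Φ z.1 :=
    Fintype.expect_equiv hinv.toPerm _ _ fun z => rfl
  have h2 : 𝔼 z : (ι → β) × β, Φ (Function.update z.1 i z.2)
      = 𝔼 x, 𝔼 a, Φ (Function.update x i a) := by
    rw [← univ_product_univ, expect_product]
  have h3 : 𝔼 z : (ι → β) × β, Φ z.1 = 𝔼 x, Φ x := by
    rw [← univ_product_univ, expect_product]
    simp
  rw [← h2, h1, h3]

end Expect

/-! ### Conditioning on one coordinate and Bessel's inequality -/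

section Spike

variable {P S : Type*} [Fintype P] [DecidableEq P] [Fintype S] [DecidableEq S] [Nonempty S]

/-- The density, relative to the uniform measure on `S`, of the point mass at `b`. -/
def spike (a b : S) : ℝ := if a = b then (Fintype.card S : ℝ) else 0

theorem spike_nonneg (a b : S) : 0 ≤ spike a b := by
  unfold spike; split_ifs <;> positivity

theorem spike_le (a b : S) : spike a b ≤ Fintype.card S := by
  unfold spike; split_ifs
  · rfl
  · positivity

theorem spike_sq (a b : S) : spike a b * spike a b = Fintype.card S * spike a b := by
  unfold spike; split_ifs <;> simp

theorem spike_mul_le {a b : S} {x y : ℝ} (h : a = b → x ≤ y) :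
    spike a b * x ≤ spike a b * y := by
  unfold spike; split_ifs with hab
  · exact mul_le_mul_of_nonneg_left (h hab) (by positivity)
  · simp

theorem expect_spike_mul (b : S) (h : S → ℝ) : 𝔼 a, spike a b * h a = h b := by
  rw [Fintype.expect_eq_sum_div_card]
  have : (Fintype.card S : ℝ) ≠ 0 := by simp
  simp only [spike, ite_mul, zero_mul, sum_ite_eq', mem_univ, if_true]
  field_simp

theorem expect_spike (b : S) : 𝔼 a, spike a b = 1 := by
  simpa using expect_spike_mul b (fun _ => 1)

theorem expect_spike_apply (p : P) (σ : S) : 𝔼 v : P → S, spike (v p) σ = 1 := by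
  rw [← expect_update p]
  simp [expect_spike]

theorem expect_spike_apply_mul_of_ne {p p' : P} (h : p ≠ p') (σ τ : S) :
    𝔼 v : P → S, spike (v p) σ * spike (v p') τ = 1 := by
  rw [← expect_update p]
  simp only [Function.update_self, Function.update_of_ne h.symm]
  simp [← expect_mul, expect_spike, expect_spike_apply]

/-- The mean of `g` conditioned on the coordinate `p` being `σ`. -/
noncomputable def rowMean (g : (P → S) → ℝ) (σ : S) (p : P) : ℝ :=
  𝔼 v, spike (v p) σ * g v

theorem rowMean_nonneg {g : (P → S) → ℝ} (hg : ∀ v, 0 ≤ g v) (σ : S) (p : P) :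
    0 ≤ rowMean g σ p :=
  expect_nonneg fun v _ => mul_nonneg (spike_nonneg _ _) (hg v)

theorem rowMean_mono {g h : (P → S) → ℝ} (hgh : ∀ v, g v ≤ h v) (σ : S) (p : P) :
    rowMean g σ p ≤ rowMean h σ p :=
  expect_le_expect fun v _ => mul_le_mul_of_nonneg_left (hgh v) (spike_nonneg _ _)

theorem rowMean_le {g : (P → S) → ℝ} (hg : ∀ v, 0 ≤ g v) (σ : S) (p : P) :
    rowMean g σ p ≤ Fintype.card S * 𝔼 v, g v := by
  rw [mul_expect]
  exact expect_le_expect fun v _ => mul_le_mul_of_nonneg_right (spike_le _ _) (hg v)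

/-- Bessel's inequality for the orthogonal family `spike (v p) σ - 1`. -/
theorem sum_sq_rowMean_sub_le (h : (P → S) → ℝ) (σ : S) :
    ∑ p, (rowMean h σ p - 𝔼 v, h v) ^ 2 ≤ Fintype.card S * 𝔼 v, h v ^ 2 := by
  set s : ℝ := (Fintype.card S : ℝ) with hs
  have hs1 : 1 ≤ s := by
    rw [hs]; exact_mod_cast Fintype.card_pos
  set c : P → ℝ := fun p => rowMean h σ p - 𝔼 v, h v with hc
  have hcE : ∀ p, c p = 𝔼 v : P → S, (spike (v p) σ - 1) * h v := by
    intro p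
    simp only [hc, rowMean, sub_mul, one_mul, expect_sub_distrib]
  have horth : ∀ p p' : P, 𝔼 v : P → S, (spike (v p) σ - 1) * (spike (v p') σ - 1)
      = if p = p' then s - 1 else 0 := by
    intro p p'
    have e : ∀ v : P → S, (spike (v p) σ - 1) * (spike (v p') σ - 1)
        = spike (v p) σ * spike (v p') σ - spike (v p) σ - spike (v p') σ + 1 := fun v => by ring
    simp only [e, expect_add_distrib, expect_sub_distrib, expect_spike_apply]
    rw [Fintype.expect_const]
    split_ifs with hpp
    · subst hpp
      simp only [spike_sq, ← mul_expect, expect_spike_apply]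
      ring
    · rw [expect_spike_apply_mul_of_ne hpp]; ring
  have h1 : 𝔼 v, h v * ∑ p, c p * (spike (v p) σ - 1) = ∑ p, c p ^ 2 := by
    simp only [mul_sum]
    rw [expect_sum_comm]
    refine sum_congr rfl fun p _ => ?_
    rw [sq]
    conv_rhs => rw [hcE p, mul_expect]
    refine expect_congr rfl fun v _ => ?_
    rw [← hcE p]; ring
  have h2 : 𝔼 v : P → S, (∑ p, c p * (spike (v p) σ - 1)) ^ 2 = (s - 1) * ∑ p, c p ^ 2 := by
    have e : ∀ v : P → S, (∑ p, c p * (spike (v p) σ - 1)) ^ 2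
        = ∑ p, ∑ p', c p * c p' * ((spike (v p) σ - 1) * (spike (v p') σ - 1)) := by
      intro v
      rw [sq, sum_mul_sum]
      exact sum_congr rfl fun p _ => sum_congr rfl fun p' _ => by ring
    simp only [e]
    rw [expect_sum_comm, mul_sum]
    refine sum_congr rfl fun p _ => ?_
    rw [expect_sum_comm]
    simp only [← mul_expect, horth]
    simp
    ring
  -- The optimal coefficient would be `(s - 1)⁻¹`; the choice `s⁻¹` costs little and also covers `s
  -- = 1`.
  have h3 : 0 ≤ 𝔼 v, (h v - s⁻¹ * ∑ p, c p * (spike (v p) σ - 1)) ^ 2 :=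
    expect_nonneg fun v _ => sq_nonneg _
  have e3 : ∀ v, (h v - s⁻¹ * ∑ p, c p * (spike (v p) σ - 1)) ^ 2
      = h v ^ 2 - 2 * s⁻¹ * (h v * ∑ p, c p * (spike (v p) σ - 1))
        + s⁻¹ ^ 2 * (∑ p, c p * (spike (v p) σ - 1)) ^ 2 := fun v => by ring
  simp only [e3, expect_add_distrib, expect_sub_distrib, ← mul_expect, h1, h2] at h3
  set X := ∑ p, c p ^ 2
  have hX : 0 ≤ X := sum_nonneg fun p _ => sq_nonneg _
  have e4 : s * ((𝔼 v, h v ^ 2) - 2 * s⁻¹ * X + s⁻¹ ^ 2 * ((s - 1) * X))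
      = s * (𝔼 v, h v ^ 2) - X - s⁻¹ * X := by
    field_simp; ring
  have h5 := mul_nonneg (by linarith : (0 : ℝ) ≤ s) h3
  rw [e4] at h5
  have : 0 ≤ s⁻¹ * X := by positivity
  linarith

/-- Chebyshev's inequality, for counting exceptional coordinates. -/
theorem card_mul_le_of_sum_sq_le {c : P → ℝ} {t C : ℝ} (ht : 0 ≤ t) (h : ∑ p, c p ^ 2 ≤ C)
    (s : Finset P) (hs : ∀ p ∈ s, t ≤ |c p|) : (#s : ℝ) * t ^ 2 ≤ C := by
  refine le_trans ?_ h
  calc (#s : ℝ) * t ^ 2 = ∑ p ∈ s, t ^ 2 := by simp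
    _ ≤ ∑ p ∈ s, c p ^ 2 := sum_le_sum fun p hp => by
        rw [← sq_abs (c p)]; exact pow_le_pow_left₀ ht (hs p hp) 2
    _ ≤ ∑ p, c p ^ 2 := sum_le_sum_of_subset_of_nonneg (subset_univ _) fun p _ _ => sq_nonneg _

end Spike

/-! ### Typical entries in a single row -/

section Row

variable {P S : Type*} [Fintype P] [DecidableEq P] [Fintype S] [DecidableEq S] [Nonempty S]

/-- The mean of `g` conditioned on the coordinates `p`, `p'` being `σ`, `τ`. -/
noncomputable def rowMean₂ (g : (P → S) → ℝ) (σ τ : S) (p p' : P) : ℝ :=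
  rowMean (fun v => spike (v p) σ * g v) τ p'

theorem rowMean₂_mono {g h : (P → S) → ℝ} (hgh : ∀ v, g v ≤ h v) (σ τ : S) (p p' : P) :
    rowMean₂ g σ τ p p' ≤ rowMean₂ h σ τ p p' :=
  rowMean_mono (fun v => mul_le_mul_of_nonneg_left (hgh v) (spike_nonneg _ _)) τ p'

/-- For a bounded function, conditioning on one coordinate hardly changes the mean, up to a small
number of exceptional coordinates. -/
theorem card_rowMean_deviation_le {g : (P → S) → ℝ} {θ κ μ : ℝ} (hg : ∀ v, 0 ≤ g v)
    (hθ : ∀ v, g v ≤ θ) (hμ : 𝔼 v, g v = μ) (hμ0 : 0 < μ) (hκ : θ ≤ κ * μ) (σ : S) (s : Finset P)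
    (hs : ∀ p ∈ s, μ / 8 ≤ |rowMean g σ p - μ|) : (#s : ℝ) ≤ 64 * Fintype.card S * κ := by
  have h1 := sum_sq_rowMean_sub_le g σ
  rw [hμ] at h1
  have h2 : 𝔼 v, g v ^ 2 ≤ κ * μ * μ := by
    calc 𝔼 v, g v ^ 2 ≤ 𝔼 v, θ * g v := expect_le_expect fun v _ => by
          rw [sq]; exact mul_le_mul_of_nonneg_right (hθ v) (hg v)
      _ = θ * μ := by rw [← mul_expect, hμ]
      _ ≤ κ * μ * μ := mul_le_mul_of_nonneg_right hκ hμ0.le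
  have h3 := card_mul_le_of_sum_sq_le (by positivity)
    (h1.trans (mul_le_mul_of_nonneg_left h2 (by positivity))) s hs
  have h4 : (#s : ℝ) * μ ^ 2 ≤ (64 * Fintype.card S * κ) * μ ^ 2 := by linarith
  exact le_of_mul_le_mul_right h4 (by positivity)

/-- Bessel's inequality applied to `spike (v p) σ * g v`. Its second moment is controlled because `g
≤ θ` and its mean `rowMean g σ p` is at most `9 / 8 * μ`. -/
theorem card_rowMean₂_deviation_le {g : (P → S) → ℝ} {θ κ μ : ℝ} (hg : ∀ v, 0 ≤ g v)
    (hθ : ∀ v, g v ≤ θ) (hμ0 : 0 < μ) (hκ : θ ≤ κ * μ) (σ τ : S) (p : P)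
    (hp : rowMean g σ p ≤ 9 / 8 * μ) (s : Finset P)
    (hs : ∀ p' ∈ s, rowMean₂ g σ τ p p' < rowMean g σ p - μ / 8) :
    (#s : ℝ) ≤ 72 * (Fintype.card S : ℝ) ^ 2 * κ := by
  have hθ0 : 0 ≤ θ := (hg fun _ => Classical.arbitrary S).trans (hθ _)
  have h1 := sum_sq_rowMean_sub_le (fun v => spike (v p) σ * g v) τ
  have h2 : 𝔼 v, (spike (v p) σ * g v) ^ 2 ≤ Fintype.card S * (κ * μ * (9 / 8 * μ)) := by
    calc 𝔼 v, (spike (v p) σ * g v) ^ 2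
        ≤ 𝔼 v, Fintype.card S * (θ * (spike (v p) σ * g v)) := expect_le_expect fun v _ => by
          have := spike_sq (v p) σ
          have e : (spike (v p) σ * g v) ^ 2 = Fintype.card S * (spike (v p) σ * (g v * g v)) := by
            rw [mul_pow, sq, this]; ring
          rw [e]
          refine mul_le_mul_of_nonneg_left ?_ (by positivity)
          have := mul_le_mul_of_nonneg_left (mul_le_mul_of_nonneg_right (hθ v) (hg v))
            (spike_nonneg (v p) σ)
          linarith
      _ = Fintype.card S * (θ * rowMean g σ p) := by
          rw [rowMean, mul_expect, mul_expect]
      _ ≤ _ := mul_le_mul_of_nonneg_left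
        (mul_le_mul hκ hp (rowMean_nonneg hg σ p) (hθ0.trans hκ)) (by positivity)
  have h3 := card_mul_le_of_sum_sq_le (t := μ / 8) (by positivity)
    (h1.trans (mul_le_mul_of_nonneg_left h2 (by positivity))) s (fun p' hp' => by
      have := hs p' hp'
      rw [rowMean₂] at this
      have h5 : rowMean (fun v => spike (v p) σ * g v) τ p' - 𝔼 v, spike (v p) σ * g v
          ≤ -(μ / 8) := by
        rw [rowMean] at this ⊢
        rw [rowMean] at this
        linarith
      rw [abs_of_nonpos (by linarith [hμ0])]
      linarith)
  have h4 : (#s : ℝ) * μ ^ 2 ≤ (72 * (Fintype.card S : ℝ) ^ 2 * κ) * μ ^ 2 := by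
    nlinarith
  exact le_of_mul_le_mul_right h4 (by positivity)

/-- The coordinates `p` at which the mean of `g` conditioned on `v p = o` is not much larger than
when conditioned otherwise, and at which `f` is not among its `2 * m` largest values. -/
def RowTypical (f : P → ℝ) (g : (P → S) → ℝ) (o : S) (m : ℕ) (p : P) : Prop :=
  (∀ σ, rowMean g o p / 2 ≤ rowMean g σ p) ∧
  (∀ σ, ∀ s : Finset P, (∀ p' ∈ s, rowMean₂ g σ o p p' < rowMean g o p / 2) → #s ≤ m) ∧
  ∃ s : Finset P, 2 * m ≤ #s ∧ ∀ p' ∈ s, f p ≤ f p'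

open Classical in
/-- The mass of the pairs `(p, v)` at which `f` or `g` is much larger than its conditional mean. -/
noncomputable def rowSpread (f : P → ℝ) (g : (P → S) → ℝ) (o : S) (Λ : ℝ) : ℝ :=
  𝔼 p, 𝔼 v, spike (v p) o * (f p * g v) *
    if Λ * (𝔼 p', spike (v p') o * f p') < f p ∨ Λ * rowMean g o p < g v then 1 else 0

/-- At a minimizer of `f` on `s`, the set `s` itself lies above. -/
theorem card_lt_of_forall_few_above (f : P → ℝ) {m : ℕ} (hm : 0 < m) (s : Finset P)
    (hs : ∀ p ∈ s, ¬ ∃ t : Finset P, m ≤ #t ∧ ∀ p' ∈ t, f p ≤ f p') : #s < m := by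
  rcases s.eq_empty_or_nonempty with rfl | hne
  · simpa using hm
  · obtain ⟨p, hp, hmin⟩ := exists_min_image s f hne
    by_contra! hcon
    exact hs p hp ⟨s, hcon, hmin⟩

open Classical in
/-- Small sets of coordinates carry little mass. -/
theorem expect_small_set_le {f : P → ℝ} {g : (P → S) → ℝ} (hf : ∀ p, 0 ≤ f p)
    (hg : ∀ v, 0 ≤ g v) (o : S) {Λ : ℝ} (hΛ : 0 ≤ Λ) (W : Finset P) :
    (𝔼 p, f p * rowMean g o p * if p ∈ W then 1 else 0) ≤
      rowSpread f g o Λ +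
        #W * Fintype.card S * Λ / Fintype.card P * 𝔼 p, f p * rowMean g o p := by
  -- Outside the spread, `f p` is at most `Λ` times its conditional mean, so a single coordinate
  -- carries a share of at most `|S| Λ / |P|` of the mass.
  have key : ∀ p v, spike (v p) o * (f p * g v) * (if p ∈ W then (1 : ℝ) else 0) ≤
      (spike (v p) o * (f p * g v) *
        if Λ * (𝔼 p', spike (v p') o * f p') < f p ∨ Λ * rowMean g o p < g v then 1 else 0) +
      (if p ∈ W then 1 else 0) *
        (Fintype.card S * (Λ * ((𝔼 p', spike (v p') o * f p') * g v))) := by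
    intro p v
    have h1 := spike_nonneg (v p) o
    have h2 := hf p
    have h3 := hg v
    have h4 : 0 ≤ 𝔼 p', spike (v p') o * f p' :=
      expect_nonneg fun p' _ => mul_nonneg (spike_nonneg _ _) (hf p')
    by_cases hW : p ∈ W
    · simp only [hW, if_true, mul_one, one_mul]
      split_ifs with hc
      · have : 0 ≤ (Fintype.card S : ℝ) * (Λ * ((𝔼 p', spike (v p') o * f p') * g v)) := by
          positivity
        linarith
      · push Not at hc
        rw [mul_zero, zero_add]
        calc spike (v p) o * (f p * g v)
            ≤ Fintype.card S * (f p * g v) := mul_le_mul_of_nonneg_right (spike_le _ _)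
              (by positivity)
          _ ≤ Fintype.card S * ((Λ * 𝔼 p', spike (v p') o * f p') * g v) := by
              gcongr; exact hc.1
          _ = _ := by ring
    · simp only [hW, if_false, mul_zero, zero_mul, add_zero]
      split_ifs <;> positivity
  have hL : (𝔼 p, f p * rowMean g o p * if p ∈ W then 1 else 0)
      = 𝔼 p, 𝔼 v, spike (v p) o * (f p * g v) * (if p ∈ W then (1 : ℝ) else 0) := by
    refine expect_congr rfl fun p _ => ?_
    rw [rowMean, mul_expect, expect_mul]
    exact expect_congr rfl fun v _ => by ring
  have hT : 𝔼 p, f p * rowMean g o p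
      = 𝔼 v, (𝔼 p', spike (v p') o * f p') * g v := by
    simp only [rowMean, mul_expect, expect_mul]
    rw [expect_comm]
    exact expect_congr rfl fun v _ => expect_congr rfl fun p _ => by ring
  rw [hL]
  refine (expect_le_expect fun p _ => expect_le_expect fun v _ => key p v).trans ?_
  simp only [expect_add_distrib, ← mul_expect]
  refine add_le_add le_rfl (le_of_eq ?_)
  rw [← hT, ← expect_mul, Fintype.expect_eq_sum_div_card]
  simp
  ring

theorem rowMean_eq_add_truncation (g : (P → S) → ℝ) (o : S) (p : P) (c : ℝ) :
    rowMean g o p = rowMean (fun v => if g v ≤ c then g v else 0) o p +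
      𝔼 v, spike (v p) o * (g v * if c < g v then 1 else 0) := by
  rw [rowMean, rowMean, ← expect_add_distrib]
  refine expect_congr rfl fun v _ => ?_
  by_cases h : g v ≤ c
  · simp [h, not_lt.2 h]
  · simp [h, not_le.1 h]

-- A failure of typicality has three sources: most of the conditional mean of `g` comes from huge
-- values, which is charged to `rowSpread`; the truncated `g` deviates at `p`, which Bessel's
-- inequality allows for at most `m` coordinates; or `f p` is among the top values, fewer than `2 *
-- m` coordinates. The last two sets are small and `expect_small_set_le` applies.
open Classical in
theorem expect_not_typical_le [Nonempty P] {f : P → ℝ} {g : (P → S) → ℝ} (hf : ∀ p, 0 ≤ f p)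
    (hg : ∀ v, 0 ≤ g v) (o : S) {Λ : ℝ} (hΛ : 0 < Λ) {m : ℕ} (hm0 : 0 < m)
    (hm : 96 * (Fintype.card S : ℝ) ^ 3 * Λ ≤ m) :
    (𝔼 p, f p * rowMean g o p * if RowTypical f g o m p then 0 else 1) ≤
      5 * rowSpread f g o Λ +
        3 * m * Fintype.card S * Λ / Fintype.card P * 𝔼 p, f p * rowMean g o p := by
  set b : P → ℝ := rowMean g o with hb
  have hb0 : ∀ p, 0 ≤ b p := rowMean_nonneg hg o
  set s : ℝ := (Fintype.card S : ℝ) with hs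
  have hs1 : 1 ≤ s := by rw [hs]; exact_mod_cast Fintype.card_pos
  set cut : P → (P → S) → ℝ := fun p v => if g v ≤ Λ * b p then g v else 0 with hcut
  set ok : P → Prop := fun p => 3 / 4 * b p ≤ rowMean (cut p) o p with hok
  -- the coordinates which are not `ok` carry little mass
  have h_not_ok : (𝔼 p, f p * b p * if ok p then 0 else 1) ≤ 4 * rowSpread f g o Λ := by
    rw [rowSpread, mul_expect]
    refine expect_le_expect fun p _ => ?_
    split_ifs with hp
    · rw [mul_zero]
      refine mul_nonneg (by norm_num) (expect_nonneg fun v _ => ?_)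
      have := spike_nonneg (v p) o
      have := hf p
      have := hg v
      split_ifs <;> positivity
    · simp only [hok, not_le] at hp
      have e := rowMean_eq_add_truncation g o p (Λ * b p)
      change b p = rowMean (cut p) o p + _ at e
      have h1 : b p ≤ 4 * 𝔼 v, spike (v p) o * (g v * if Λ * b p < g v then 1 else 0) := by
        linarith
      calc f p * b p * 1 ≤ f p * (4 * 𝔼 v, spike (v p) o *
            (g v * if Λ * b p < g v then 1 else 0)) := by
              rw [mul_one]; exact mul_le_mul_of_nonneg_left h1 (hf p)
        _ = 4 * 𝔼 v, spike (v p) o * (f p * g v) * (if Λ * b p < g v then 1 else 0) := by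
              rw [mul_left_comm, mul_expect]
              congr 1
              exact expect_congr rfl fun v _ => by ring
        _ ≤ _ := by
              refine mul_le_mul_of_nonneg_left (expect_le_expect fun v _ => ?_) (by norm_num)
              have := spike_nonneg (v p) o
              have := hf p
              have := hg v
              refine mul_le_mul_of_nonneg_left ?_ (by positivity)
              by_cases h : Λ * b p < g v
              · simp [h, ← hb]
              · simp only [h, if_false]
                split_ifs <;> norm_num
  -- off a small exceptional set, the `ok` coordinates with positive mass are typical
  obtain ⟨W, hWc, hW⟩ : ∃ W : Finset P, (#W : ℝ) ≤ 3 * m ∧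
      ∀ p, p ∉ W → ok p → 0 < b p → RowTypical f g o m p := by
    by_cases hne : ∃ p, ok p ∧ 0 < b p
    swap
    · refine ⟨∅, by simp, fun p _ h1 h2 => absurd ⟨p, h1, h2⟩ hne⟩
    obtain ⟨p₁, hp₁, hbp₁⟩ := hne
    -- Truncating at the largest `Λ * b p` among the `ok` coordinates gives one bounded function
    -- that serves all of them.
    obtain ⟨p₀, hp₀, hmax⟩ := exists_max_image (univ.filter ok) b ⟨p₁, by simpa using hp₁⟩
    simp only [mem_filter, mem_univ, true_and] at hp₀ hmax
    have hb₀ : 0 < b p₀ := hbp₁.trans_le (hmax p₁ hp₁)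
    set θ := Λ * b p₀ with hθ
    set gh := cut p₀ with hgh
    have hgh0 : ∀ v, 0 ≤ gh v := by
      intro v; simp only [hgh, hcut]; split_ifs
      · exact hg v
      · rfl
    have hghg : ∀ v, gh v ≤ g v := by
      intro v; simp only [hgh, hcut]; split_ifs
      · rfl
      · exact hg v
    have hghθ : ∀ v, gh v ≤ θ := by
      intro v; simp only [hgh, hcut]; split_ifs with h
      · exact h
      · positivity
    have hcutle : ∀ p, ok p → ∀ v, cut p v ≤ gh v := by
      intro p hp v
      simp only [hgh, hcut]
      have : Λ * b p ≤ Λ * b p₀ := mul_le_mul_of_nonneg_left (hmax p hp) hΛ.le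
      by_cases h : g v ≤ Λ * b p
      · simp [h, h.trans this]
      · simp only [h, if_false]; split_ifs
        · exact hg v
        · rfl
    set μ := 𝔼 v, gh v with hμ
    -- Conditioning raises a mean by at most the factor `s`, so the truncation level is at most `4 /
    -- 3 * Λ * s` times `μ`; this ratio is the `κ` of the counting lemmas.
    have hμb : 3 / 4 * b p₀ ≤ s * μ := hp₀.trans (rowMean_le hgh0 o p₀)
    have hμ0 : 0 < μ := by
      by_contra! hcon
      have : s * μ ≤ 0 := mul_nonpos_of_nonneg_of_nonpos (by linarith) hcon
      linarith
    have hκ : θ ≤ (4 / 3 * Λ * s) * μ := by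
      rw [hθ]; nlinarith
    set W₁ : Finset P := univ.biUnion fun σ : S =>
      univ.filter fun p => μ / 8 ≤ |rowMean gh σ p - μ| with hW₁
    set W₂ : Finset P := univ.filter fun p =>
      ¬ ∃ s : Finset P, 2 * m ≤ #s ∧ ∀ p' ∈ s, f p ≤ f p' with hW₂
    refine ⟨W₁ ∪ W₂, ?_, ?_⟩
    · have h1 : (#W₁ : ℝ) ≤ m := by
        calc (#W₁ : ℝ) ≤ ∑ σ : S, (#(univ.filter fun p => μ / 8 ≤ |rowMean gh σ p - μ|) : ℝ) := by
              exact_mod_cast card_biUnion_le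
          _ ≤ ∑ σ : S, 64 * s * (4 / 3 * Λ * s) := sum_le_sum fun σ _ =>
              card_rowMean_deviation_le hgh0 hghθ hμ.symm hμ0 hκ σ _ (by simp)
          _ = 256 / 3 * s ^ 3 * Λ := by
              rw [sum_const, card_univ, nsmul_eq_mul, ← hs]; ring
          _ ≤ 96 * s ^ 3 * Λ := by
              have : 0 ≤ s ^ 3 * Λ := by positivity
              nlinarith
          _ ≤ m := hm
      have h2 : #W₂ < 2 * m := card_lt_of_forall_few_above f (by omega) _ (by simp [hW₂])
      have h3 : (#W₂ : ℝ) ≤ 2 * m := by exact_mod_cast h2.le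
      have h4 : (#(W₁ ∪ W₂) : ℝ) ≤ #W₁ + #W₂ := by exact_mod_cast card_union_le _ _
      linarith
    · intro p hpW hpok hbp
      simp only [mem_union, not_or] at hpW
      obtain ⟨hp1, hp2⟩ := hpW
      have hdev : ∀ σ, |rowMean gh σ p - μ| < μ / 8 := by
        intro σ
        by_contra! hcon
        exact hp1 (mem_biUnion.2 ⟨σ, mem_univ _, by simpa using hcon⟩)
      -- Hence `b p / 2 ≤ 3 / 4 * μ`, which is just low enough for two successive losses of `μ / 8`,
      -- one for each conditioning.
      have hbμ : 3 / 4 * b p ≤ 9 / 8 * μ := by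
        have h1 : 3 / 4 * b p ≤ rowMean gh o p := le_trans hpok (rowMean_mono (hcutle p hpok) o p)
        have := (abs_lt.1 (hdev o)).2
        linarith
      refine ⟨fun σ => ?_, fun σ t ht => ?_, ?_⟩
      · have h1 := rowMean_mono hghg σ p
        have := (abs_lt.1 (hdev σ)).1
        change b p / 2 ≤ _
        linarith
      · have h2 := card_rowMean₂_deviation_le hgh0 hghθ hμ0 hκ σ o p
          (by have := (abs_lt.1 (hdev σ)).2; linarith) t (fun p' hp' => by
            have h3 := ht p' hp'
            have h4 := rowMean₂_mono hghg σ o p p'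
            have := (abs_lt.1 (hdev σ)).1
            have h5 : rowMean g o p = b p := rfl
            linarith)
        have h3 : (#t : ℝ) ≤ m := h2.trans (le_trans (le_of_eq (by rw [← hs]; ring)) hm)
        exact_mod_cast h3
      · simpa [hW₂] using hp2
  have hsplit : ∀ p, f p * b p * (if RowTypical f g o m p then 0 else 1) ≤
      f p * b p * (if ok p then 0 else 1) + f p * b p * (if p ∈ W then 1 else 0) := by
    intro p
    have h0 : 0 ≤ f p * b p := mul_nonneg (hf p) (hb0 p)
    by_cases ht : RowTypical f g o m p
    · simp only [ht, if_true, mul_zero]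
      split_ifs <;> simp [h0]
    · rcases (hb0 p).eq_or_lt with hz | hz
      · simp [← hz]
      · by_cases h1 : ok p
        · have h2 : p ∈ W := by
            by_contra h2
            exact ht (hW p h2 h1 hz)
          simp [ht, h1, h2]
        · simp only [ht, h1, if_false, mul_one]
          split_ifs <;> simp [h0]
  refine (expect_le_expect fun p _ => hsplit p).trans ?_
  rw [expect_add_distrib]
  have h1 := expect_small_set_le hf hg o hΛ.le W
  have h2 : (#W : ℝ) * Fintype.card S * Λ / Fintype.card P * 𝔼 p, f p * rowMean g o p ≤
      3 * m * s * Λ / Fintype.card P * 𝔼 p, f p * b p := by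
    have : 0 ≤ 𝔼 p, f p * b p := expect_nonneg fun p _ => mul_nonneg (hf p) (hb0 p)
    change (#W : ℝ) * s * Λ / Fintype.card P * 𝔼 p, f p * b p ≤ _
    gcongr
  linarith

end Row

/-! ### Layer-cake transfer of mass between the blocks of a row -/

section LayerCake

/-- Abel summation: a sum weighted by `f` is nonnegative if it is so over all superlevel sets. -/
theorem sum_mul_nonneg_of_superlevel {P : Type*} (n : ℕ) : ∀ (s : Finset P) (f δ : P → ℝ),
    #s ≤ n → (∀ p ∈ s, 0 ≤ f p) →
    (∀ t : ℝ, 0 < t → 0 ≤ ∑ p ∈ s with t ≤ f p, δ p) → 0 ≤ ∑ p ∈ s, f p * δ p := by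
  classical
  induction n with
  | zero =>
    intro s f δ hs _ _
    have : s = ∅ := by simpa using hs
    simp [this]
  | succ n ih =>
    intro s f δ hs hf h
    rcases s.eq_empty_or_nonempty with rfl | hne
    · simp
    -- Peel off the lowest layer: after subtracting the minimum, `p₀` has weight zero and the
    -- superlevel sets at positive heights are among the old ones.
    obtain ⟨p₀, hp₀, hmin⟩ := exists_min_image s f hne
    set c := f p₀
    have hsplit : ∑ p ∈ s, f p * δ p = c * ∑ p ∈ s, δ p + ∑ p ∈ s.erase p₀, (f p - c) * δ p := by
      have : ∑ p ∈ s.erase p₀, (f p - c) * δ p = ∑ p ∈ s, (f p - c) * δ p := by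
        rw [← add_sum_erase s _ hp₀]
        simp [c]
      rw [this, mul_sum, ← sum_add_distrib]
      exact sum_congr rfl fun p _ => by ring
    rw [hsplit]
    refine add_nonneg ?_ (ih _ _ _ ?_ ?_ ?_)
    · rcases (hf p₀ hp₀).eq_or_lt with h0 | h0
      · rw [show c = 0 from h0.symm]; simp
      · refine mul_nonneg h0.le ?_
        have := h c h0
        rwa [filter_true_of_mem fun p hp => hmin p hp] at this
    · rw [card_erase_of_mem hp₀]; omega
    · exact fun p hp => sub_nonneg.2 (hmin p (mem_of_mem_erase hp))
    · intro t ht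
      have := h (t + c) (by have := hf p₀ hp₀; change 0 ≤ c at this; linarith)
      have e : (s.erase p₀).filter (fun p => t ≤ f p - c) = s.filter (fun p => t + c ≤ f p) := by
        ext p
        simp only [mem_filter, mem_erase]
        constructor
        · rintro ⟨⟨_, h1⟩, h2⟩; exact ⟨h1, by linarith⟩
        · rintro ⟨h1, h2⟩
          refine ⟨⟨?_, h1⟩, by linarith⟩
          rintro rfl
          change t + c ≤ c at h2
          linarith
      rwa [e]

variable {P : Type*} [Fintype P]

open Classical in
/-- Transfer of mass between coordinates: `b p` is bounded by `2 * φ p p'` for most `p'`, and the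
averages of `φ · p'` are bounded by `ψ p'`. -/
theorem sum_mul_le_of_layers {f b ψ : P → ℝ} {φ : P → P → ℝ} {m : ℕ} {c : ℝ} (hm : 0 < m)
    (hf : ∀ p, 0 ≤ f p) (hb : ∀ p, 0 ≤ b p) (hφ : ∀ p p', 0 ≤ φ p p')
    (hbφ : ∀ p, 0 < b p → ∀ s : Finset P, (∀ p' ∈ s, φ p p' < b p / 2) → #s ≤ m)
    (hψ : ∀ p' (s : Finset P), ∑ p ∈ s, φ p p' ≤ c * #s * ψ p')
    (htop : ∀ p, 0 < b p → ∃ s : Finset P, 2 * m ≤ #s ∧ ∀ p' ∈ s, f p ≤ f p') :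
    ∑ p, f p * b p ≤ 4 * c * ∑ p, f p * ψ p := by
  have hψ0 : ∀ p', 0 ≤ c * ψ p' := by
    intro p'
    have h1 := hψ p' {p'}
    simp only [sum_singleton, card_singleton] at h1
    have := hφ p' p'
    push_cast at h1
    linarith
  suffices h : 0 ≤ ∑ p, f p * (4 * c * ψ p - b p) by
    have e : ∑ p, f p * (4 * c * ψ p - b p) = 4 * c * ∑ p, f p * ψ p - ∑ p, f p * b p := by
      rw [mul_sum, ← sum_sub_distrib]
      exact sum_congr rfl fun p _ => by ring
    linarith
  refine sum_mul_nonneg_of_superlevel _ univ f _ le_rfl (fun p _ => hf p) fun t ht => ?_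
  set V := univ.filter fun p => t ≤ f p with hV
  rw [sum_sub_distrib, sub_nonneg, ← mul_sum]
  by_cases hz : ∀ p ∈ V, b p = 0
  · rw [sum_congr rfl hz, mul_sum]
    simp only [sum_const_zero]
    exact sum_nonneg fun p _ => by have := hψ0 p; linarith
  push Not at hz
  obtain ⟨p₁, hp₁V, hp₁⟩ := hz
  -- One element of `V` with `b` positive brings at least `2 * m` elements above it into `V`, so the
  -- at most `m` exceptions fill no more than half of `V`.
  have hVcard : 2 * m ≤ #V := by
    obtain ⟨s, hs, hs'⟩ := htop p₁ (lt_of_le_of_ne (hb p₁) hp₁.symm)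
    refine hs.trans (card_le_card fun p' hp' => ?_)
    simp only [hV, mem_filter, mem_univ, true_and] at hp₁V ⊢
    exact hp₁V.trans (hs' p' hp')
  have hVR : (2 * m : ℝ) ≤ #V := by exact_mod_cast hVcard
  have hmR : (0 : ℝ) < m := by exact_mod_cast hm
  have hrow : ∀ p ∈ V, (#V : ℝ) / 4 * b p ≤ ∑ p' ∈ V, φ p p' := by
    intro p hp
    rcases (hb p).eq_or_lt with h0 | h0
    · rw [← h0, mul_zero]; exact sum_nonneg fun p' _ => hφ p p'
    have h1 := hbφ p h0 (V.filter fun p' => φ p p' < b p / 2) (by simp)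
    have h2 := card_filter_add_card_filter_not (s := V) (fun p' => φ p p' < b p / 2)
    have h3 : (#V : ℝ) / 2 ≤ #(V.filter fun p' => ¬ φ p p' < b p / 2) := by
      have h4 : (#(V.filter fun p' => φ p p' < b p / 2) : ℝ) ≤ m := by exact_mod_cast h1
      have h5 : (#(V.filter fun p' => φ p p' < b p / 2) : ℝ) +
        #(V.filter fun p' => ¬ φ p p' < b p / 2) = #V := by exact_mod_cast h2
      linarith
    calc (#V : ℝ) / 4 * b p = #V / 2 * (b p / 2) := by ring
      _ ≤ #(V.filter fun p' => ¬ φ p p' < b p / 2) * (b p / 2) := by gcongr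
      _ = ∑ p' ∈ V.filter fun p' => ¬ φ p p' < b p / 2, b p / 2 := by
          rw [sum_const, nsmul_eq_mul]
      _ ≤ ∑ p' ∈ V.filter fun p' => ¬ φ p p' < b p / 2, φ p p' :=
          sum_le_sum fun p' hp' => not_lt.1 (mem_filter.1 hp').2
      _ ≤ ∑ p' ∈ V, φ p p' :=
          sum_le_sum_of_subset_of_nonneg (filter_subset _ _) fun p' _ _ => hφ p p'
  -- Double counting of `φ` over `V × V`.
  have h6 : (#V : ℝ) / 4 * ∑ p ∈ V, b p ≤ c * #V * ∑ p' ∈ V, ψ p' := by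
    rw [mul_sum, mul_sum]
    calc ∑ p ∈ V, (#V : ℝ) / 4 * b p ≤ ∑ p ∈ V, ∑ p' ∈ V, φ p p' := sum_le_sum hrow
      _ = ∑ p' ∈ V, ∑ p ∈ V, φ p p' := sum_comm
      _ ≤ _ := sum_le_sum fun p' _ => hψ p' V
  have h7 : (0 : ℝ) < #V := by linarith
  have h8 : #V * ∑ p ∈ V, b p ≤ #V * (4 * c * ∑ p' ∈ V, ψ p') := by linarith
  exact le_of_mul_le_mul_left h8 h7

end LayerCake

/-! ### Revealing the rows one at a time -/

section Chain

variable {K : ℕ} {P S : Type*} [Fintype P] [DecidableEq P] [Nonempty P]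
  [Fintype S] [DecidableEq S] [Nonempty S]

/-- The mass of `f ⊗ g` on the pairs `(x, y)` with `y i (x i) = t i` for all `i`. -/
noncomputable def rectMass (t : Fin K → S) (f : (Fin K → P) → ℝ) (g : (Fin K → P → S) → ℝ) : ℝ :=
  𝔼 x, 𝔼 y, (∏ i, spike (y i (x i)) (t i)) * (f x * g y)

/-- The mean of `f` over the coordinates `i ≥ j` of `x`, weighted by `y i (x i) = t i`. -/
noncomputable def condRows (t : Fin K → S) (f : (Fin K → P) → ℝ) (j : ℕ)
    (x : Fin K → P) (y : Fin K → P → S) : ℝ :=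
  𝔼 x' : Fin K → P, (∏ i : Fin K, if (i : ℕ) < j then 1 else spike (y i (x' i)) (t i)) *
    f fun i : Fin K => if (i : ℕ) < j then x i else x' i

/-- The mean of `g` over the coordinates `i < j` of `y`, weighted by `y i (x i) = t i`. -/
noncomputable def condCols (t : Fin K → S) (g : (Fin K → P → S) → ℝ) (j : ℕ)
    (x : Fin K → P) (y : Fin K → P → S) : ℝ :=
  𝔼 y' : Fin K → P → S, (∏ i : Fin K, if (i : ℕ) < j then spike (y' i (x i)) (t i) else 1) *
    g fun i : Fin K => if (i : ℕ) < j then y' i else y i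

variable {t : Fin K → S} {f : (Fin K → P) → ℝ} {g : (Fin K → P → S) → ℝ}

theorem condRows_nonneg (hf : ∀ x, 0 ≤ f x) (j : ℕ) (x y) : 0 ≤ condRows t f j x y :=
  expect_nonneg fun x' _ => mul_nonneg
    (prod_nonneg fun i _ => by split_ifs; exacts [zero_le_one, spike_nonneg _ _]) (hf _)

theorem condCols_nonneg (hg : ∀ y, 0 ≤ g y) (j : ℕ) (x y) : 0 ≤ condCols t g j x y :=
  expect_nonneg fun x' _ => mul_nonneg
    (prod_nonneg fun i _ => by split_ifs; exacts [spike_nonneg _ _, zero_le_one]) (hg _)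

/-- Both conditional means at stage `j` read only the entries of `x` below `j` and the rows of `y`
from `j` on. This locality lets one factor be pulled out while a row of the other is resampled. -/
theorem condRows_update_left {j : ℕ} {i : Fin K} (h : j ≤ i) (x : Fin K → P) (y) (p : P) :
    condRows t f j (Function.update x i p) y = condRows t f j x y := by
  unfold condRows
  refine expect_congr rfl fun x' _ => ?_
  congr 2
  funext k
  split_ifs with hk
  · rw [Function.update_of_ne]
    rintro rfl; omega
  · rfl

theorem condRows_update_right {j : ℕ} {i : Fin K} (h : (i : ℕ) < j) (x : Fin K → P) (y)
    (v : P → S) : condRows t f j x (Function.update y i v) = condRows t f j x y := by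
  unfold condRows
  refine expect_congr rfl fun x' _ => ?_
  congr 1
  refine prod_congr rfl fun k _ => ?_
  split_ifs with hk
  · rfl
  · rw [Function.update_of_ne]
    rintro rfl; omega

theorem condCols_update_left {j : ℕ} {i : Fin K} (h : j ≤ i) (x : Fin K → P) (y) (p : P) :
    condCols t g j (Function.update x i p) y = condCols t g j x y := by
  unfold condCols
  refine expect_congr rfl fun x' _ => ?_
  congr 1
  refine prod_congr rfl fun k _ => ?_
  split_ifs with hk
  · rw [Function.update_of_ne]
    rintro rfl; omega
  · rfl

theorem condCols_update_right {j : ℕ} {i : Fin K} (h : (i : ℕ) < j) (x : Fin K → P) (y)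
    (v : P → S) : condCols t g j x (Function.update y i v) = condCols t g j x y := by
  unfold condCols
  refine expect_congr rfl fun x' _ => ?_
  congr 2
  funext k
  split_ifs with hk
  · rfl
  · rw [Function.update_of_ne]
    rintro rfl; omega

theorem condRows_congr_target {t' : Fin K → S} {j : ℕ} (h : ∀ i : Fin K, j ≤ i → t i = t' i)
    (x y) : condRows t f j x y = condRows t' f j x y := by
  unfold condRows
  refine expect_congr rfl fun x' _ => ?_
  congr 1
  refine prod_congr rfl fun k _ => ?_
  split_ifs with hk
  · rfl
  · rw [h k (by omega)]

theorem condCols_congr_target {t' : Fin K → S} {j : ℕ} (h : ∀ i : Fin K, (i : ℕ) < j → t i = t' i)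
    (x y) : condCols t g j x y = condCols t' g j x y := by
  unfold condCols
  refine expect_congr rfl fun x' _ => ?_
  congr 1
  refine prod_congr rfl fun k _ => ?_
  split_ifs with hk
  · rw [h k hk]
  · rfl

theorem condRows_last (x : Fin K → P) (y : Fin K → P → S) : condRows t f K x y = f x := by
  simp [condRows]

theorem condCols_zero (x : Fin K → P) (y : Fin K → P → S) : condCols t g 0 x y = g y := by
  simp [condCols]

/-- The tower property for the entry of `x` in row `j`. -/
theorem condRows_eq_expect (j : Fin K) (x : Fin K → P) (y : Fin K → P → S) :
    condRows t f j x y =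
      𝔼 p, spike (y j p) (t j) * condRows t f (j + 1) (Function.update x j p) y := by
  unfold condRows
  rw [← expect_update j, expect_comm]
  refine expect_congr rfl fun p _ => ?_
  rw [mul_expect]
  refine expect_congr rfl fun x' _ => ?_
  rw [← mul_assoc]
  congr 1
  · rw [← mul_prod_erase univ _ (mem_univ j), ← mul_prod_erase univ
      (fun i : Fin K => if (i : ℕ) < j + 1 then (1 : ℝ) else spike (y i (x' i)) (t i)) (mem_univ j)]
    simp only [lt_irrefl, if_false, Function.update_self, Nat.lt_succ_self, if_true, one_mul]
    congr 1
    refine prod_congr rfl fun i hi => ?_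
    have hne := (mem_erase.1 hi).1
    have : (i : ℕ) ≠ j := fun h => hne (Fin.ext h)
    rw [Function.update_of_ne hne]
    by_cases h : (i : ℕ) < j
    · rw [if_pos h, if_pos (by omega)]
    · rw [if_neg h, if_neg (by omega)]
  · congr 1
    funext i
    by_cases hne : i = j
    · subst hne; simp
    · have : (i : ℕ) ≠ j := fun h => hne (Fin.ext h)
      rw [Function.update_of_ne hne, Function.update_of_ne hne]
      by_cases h : (i : ℕ) < j
      · rw [if_pos h, if_pos (by omega)]
      · rw [if_neg h, if_neg (by omega)]

theorem condCols_succ_eq_expect (j : Fin K) (x : Fin K → P) (y : Fin K → P → S) :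
    condCols t g (j + 1) x y =
      𝔼 v : P → S, spike (v (x j)) (t j) * condCols t g j x (Function.update y j v) := by
  unfold condCols
  rw [← expect_update j, expect_comm]
  refine expect_congr rfl fun v _ => ?_
  rw [mul_expect]
  refine expect_congr rfl fun y' _ => ?_
  rw [← mul_assoc]
  congr 1
  · rw [← mul_prod_erase univ _ (mem_univ j), ← mul_prod_erase univ
      (fun i : Fin K => if (i : ℕ) < j then spike (y' i (x i)) (t i) else (1 : ℝ)) (mem_univ j)]
    simp only [lt_irrefl, if_false, Function.update_self, Nat.lt_succ_self, if_true, one_mul]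
    congr 1
    refine prod_congr rfl fun i hi => ?_
    have hne := (mem_erase.1 hi).1
    have : (i : ℕ) ≠ j := fun h => hne (Fin.ext h)
    rw [Function.update_of_ne hne]
    by_cases h : (i : ℕ) < j
    · rw [if_pos h, if_pos (by omega)]
    · rw [if_neg h, if_neg (by omega)]
  · congr 1
    funext i
    by_cases hne : i = j
    · subst hne; simp
    · have : (i : ℕ) ≠ j := fun h => hne (Fin.ext h)
      rw [Function.update_of_ne hne, Function.update_of_ne hne]
      by_cases h : (i : ℕ) < j
      · rw [if_pos h, if_pos (by omega)]
      · rw [if_neg h, if_neg (by omega)]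

/-- Resampling the row `j`. -/
theorem expect_resample_row (j : Fin K) (Φ : (Fin K → P) → (Fin K → P → S) → ℝ) :
    𝔼 x, 𝔼 y, 𝔼 p, 𝔼 v, Φ (Function.update x j p) (Function.update y j v) = 𝔼 x, 𝔼 y, Φ x y := by
  have h1 : ∀ x : Fin K → P, 𝔼 y : Fin K → P → S, 𝔼 p, 𝔼 v,
      Φ (Function.update x j p) (Function.update y j v)
      = 𝔼 p, 𝔼 y : Fin K → P → S, Φ (Function.update x j p) y := by
    intro x
    rw [expect_comm]
    exact expect_congr rfl fun p _ => expect_update j _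
  simp only [h1]
  exact expect_update j (fun x => 𝔼 y, Φ x y)

/-- Revealing `x j` passes from stage `j` to a hybrid in which `f` is already at stage `j + 1` and
`g` still at stage `j`; `expect_condCols_eq` reaches the same hybrid from stage `j + 1`. The factor
`H` later holds a logarithm. -/
theorem expect_condRows_eq (j : Fin K) (H : (Fin K → P) → (Fin K → P → S) → ℝ)
    (hH : ∀ x y p, H (Function.update x j p) y = H x y) :
    𝔼 x, 𝔼 y, condRows t f j x y * condCols t g j x y * H x y =
      𝔼 x, 𝔼 y, spike (y j (x j)) (t j) *
        (condRows t f (j + 1) x y * condCols t g j x y * H x y) := by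
  rw [expect_comm, expect_comm (s := univ) (f := fun x y => spike (y j (x j)) (t j) *
        (condRows t f (j + 1) x y * condCols t g j x y * H x y))]
  refine expect_congr rfl fun y _ => ?_
  rw [← expect_update j (fun x => spike (y j (x j)) (t j) *
        (condRows t f (j + 1) x y * condCols t g j x y * H x y))]
  refine expect_congr rfl fun x _ => ?_
  simp only [Function.update_self, hH, condCols_update_left le_rfl]
  rw [condRows_eq_expect, expect_mul, expect_mul]
  exact expect_congr rfl fun p _ => by ring

theorem expect_condCols_eq (j : Fin K) (H : (Fin K → P) → (Fin K → P → S) → ℝ)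
    (hH : ∀ x y v, H x (Function.update y j v) = H x y) :
    𝔼 x, 𝔼 y, condRows t f (j + 1) x y * condCols t g (j + 1) x y * H x y =
      𝔼 x, 𝔼 y, spike (y j (x j)) (t j) *
        (condRows t f (j + 1) x y * condCols t g j x y * H x y) := by
  refine expect_congr rfl fun x _ => ?_
  rw [← expect_update j (fun y : Fin K → P → S => spike (y j (x j)) (t j) *
        (condRows t f (j + 1) x y * condCols t g j x y * H x y))]
  refine expect_congr rfl fun y _ => ?_
  simp only [Function.update_self, hH, condRows_update_right (Nat.lt_succ_self _)]
  rw [condCols_succ_eq_expect, mul_expect, expect_mul]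
  exact expect_congr rfl fun p _ => by ring

/-- Consecutive stages agree because both equal the same hybrid; stage `0` is the definition of
`rectMass` after renaming the average. -/
theorem expect_condRows_mul_condCols (j : ℕ) (hj : j ≤ K) :
    𝔼 x, 𝔼 y, condRows t f j x y * condCols t g j x y = rectMass t f g := by
  induction j with
  | zero =>
    have h : ∀ x y, condRows t f 0 x y * condCols t g 0 x y =
        𝔼 x' : Fin K → P, (∏ i, spike (y i (x' i)) (t i)) * (f x' * g y) := by
      intro x y
      rw [condCols_zero, condRows, expect_mul]
      refine expect_congr rfl fun x' _ => ?_
      simp [mul_assoc]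
    simp only [h]
    rw [Fintype.expect_const, expect_comm]
    rfl
  | succ j ih =>
    rw [← ih (by omega)]
    have h1 := expect_condRows_eq (t := t) (f := f) (g := g) ⟨j, hj⟩ (fun _ _ => 1)
      (fun _ _ _ => rfl)
    have h2 := expect_condCols_eq (t := t) (f := f) (g := g) ⟨j, hj⟩ (fun _ _ => 1)
      (fun _ _ _ => rfl)
    simp only [mul_one] at h1 h2
    exact h2.trans h1.symm

/-- Above the threshold the logarithm of the ratio exceeds `log Λ`; below it, `log z ≤ z - 1` shows
that the entropy term is at least `a - b`, so adding `b` restores the sign. -/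
theorem log_ratio_bound {a b Λ : ℝ} (ha : 0 ≤ a) (hb : 0 ≤ b) (hab : 0 < a → 0 < b)
    (hΛ : 0 < Λ) :
    a * (if Λ * b < a then 1 else 0) * Real.log Λ ≤ a * (Real.log a - Real.log b) + b := by
  rcases ha.eq_or_lt with h0 | h0
  · simp [← h0, hb]
  have hb' := hab h0
  split_ifs with h
  · have h1 : Real.log (Λ * b) ≤ Real.log a := Real.log_le_log (by positivity) h.le
    rw [Real.log_mul hΛ.ne' hb'.ne'] at h1
    have := mul_le_mul_of_nonneg_left (show Real.log Λ ≤ Real.log a - Real.log b by linarith) ha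
    linarith
  · have h1 := Real.log_le_sub_one_of_pos (show 0 < b / a by positivity)
    rw [Real.log_div hb'.ne' h0.ne'] at h1
    have h2 := mul_le_mul_of_nonneg_left h1 ha
    have h3 : a * (b / a - 1) = b - a := by field_simp
    rw [h3] at h2
    linarith

theorem neg_mul_log_le {z D : ℝ} (hz : 0 ≤ z) (hD : 0 < D) :
    -(z * Real.log z) ≤ -(z * Real.log D) + (D - z) := by
  rcases hz.eq_or_lt with h0 | h0
  · simp [← h0, hD.le]
  have h1 := Real.log_le_sub_one_of_pos (show 0 < D / z by positivity)
  rw [Real.log_div hD.ne' h0.ne'] at h1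
  have h2 := mul_le_mul_of_nonneg_left h1 hz
  have h3 : z * (D / z - 1) = D - z := by field_simp
  linarith

/-- Jensen's inequality for `-z log z` with weights of total mean at most one, via the tangent at
`D`. -/
theorem neg_expect_mul_log_le {X : Type*} [Fintype X] [Nonempty X] {a z : X → ℝ} {D : ℝ}
    (ha0 : ∀ i, 0 ≤ a i) (ha1 : ∀ i, a i ≤ 1) (hz : ∀ i, 0 ≤ z i) (hD : 0 < D)
    (h : 𝔼 i, a i * z i = D) :
    -(𝔼 i, a i * (z i * Real.log (z i))) ≤ -(D * Real.log D) := by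
  have h1 : ∀ i, -(a i * (z i * Real.log (z i))) ≤ -(a i * z i) * Real.log D +
      (a i * D - a i * z i) := by
    intro i
    have := mul_le_mul_of_nonneg_left (neg_mul_log_le (hz i) hD) (ha0 i)
    linarith
  rw [← expect_neg_distrib]
  refine (expect_le_expect fun i _ => h1 i).trans ?_
  rw [expect_add_distrib, expect_sub_distrib, ← expect_mul, ← expect_mul, expect_neg_distrib, h]
  have h2 : 𝔼 i, a i ≤ 1 := by
    refine (expect_le_expect fun i _ => ha1 i).trans ?_
    rw [Fintype.expect_const]
  nlinarith

end Chain

/-! ### The entropy bound and typicality in most rows -/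

section Entropy

variable {K : ℕ} {P S : Type*} [Fintype P] [DecidableEq P] [Nonempty P]
  [Fintype S] [DecidableEq S] [Nonempty S]
variable {t : Fin K → S} {f : (Fin K → P) → ℝ} {g : (Fin K → P → S) → ℝ}

theorem expect_prod_type {X Y : Type*} [Fintype X] [Fintype Y] (Φ : X → Y → ℝ) :
    𝔼 z : X × Y, Φ z.1 z.2 = 𝔼 x, 𝔼 y, Φ x y := by
  rw [← univ_product_univ, expect_product]

/-- The mass on which the mean of `f` grows by more than a factor `Λ` when `x j` is revealed. -/
theorem rows_growth_le (hf : ∀ x, 0 ≤ f x) (hg : ∀ y, 0 ≤ g y) {Λ : ℝ} (hΛ : 0 < Λ) (j : Fin K) :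
    (𝔼 x, 𝔼 y, spike (y j (x j)) (t j) * (condRows t f (j + 1) x y * condCols t g j x y *
        if Λ * condRows t f j x y < condRows t f (j + 1) x y then 1 else 0)) * Real.log Λ ≤
      (𝔼 x, 𝔼 y, condRows t f (j + 1) x y * condCols t g (j + 1) x y *
        Real.log (condRows t f (j + 1) x y)) -
      (𝔼 x, 𝔼 y, condRows t f j x y * condCols t g j x y * Real.log (condRows t f j x y)) +
      Fintype.card S * rectMass t f g := by
  rw [expect_condCols_eq j _ fun x y v => by rw [condRows_update_right (Nat.lt_succ_self _)],
    expect_condRows_eq j _ fun x y p => by rw [condRows_update_left le_rfl],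
    ← expect_condRows_mul_condCols (j : ℕ) j.2.le]
  simp only [← expect_sub_distrib, mul_expect, expect_mul, ← expect_add_distrib]
  refine expect_le_expect fun x _ => expect_le_expect fun y _ => ?_
  set A := condRows t f (j + 1) x y
  set B := condRows t f j x y with hB
  set G := condCols t g j x y
  have hA0 : 0 ≤ A := condRows_nonneg hf _ x y
  have hB0 : 0 ≤ B := condRows_nonneg hf _ x y
  have hG0 : 0 ≤ G := condCols_nonneg hg _ x y
  have h1 : spike (y j (x j)) (t j) * (A * G * (if Λ * B < A then 1 else 0) * Real.log Λ) ≤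
      spike (y j (x j)) (t j) * (A * G * Real.log A - A * G * Real.log B + B * G) := by
    refine spike_mul_le fun heq => ?_
    have hAB : 0 < A → 0 < B := by
      intro hA
      rw [hB, condRows_eq_expect]
      refine expect_pos' (fun p _ => mul_nonneg (spike_nonneg _ _) (condRows_nonneg hf _ _ _))
        ⟨x j, mem_univ _, ?_⟩
      rw [Function.update_eq_self]
      refine mul_pos ?_ hA
      rw [spike, if_pos heq]
      exact_mod_cast Fintype.card_pos
    have h2 := mul_le_mul_of_nonneg_left (log_ratio_bound hA0 hB0 hAB hΛ) hG0
    linarith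
  have h2 : spike (y j (x j)) (t j) * (B * G) ≤ Fintype.card S * (B * G) :=
    mul_le_mul_of_nonneg_right (spike_le _ _) (by positivity)
  linarith

/-- The mass on which the mean of `g` grows by more than a factor `Λ` when `y j` is revealed. -/
theorem cols_growth_le (hf : ∀ x, 0 ≤ f x) (hg : ∀ y, 0 ≤ g y) {Λ : ℝ} (hΛ : 0 < Λ) (j : Fin K) :
    (𝔼 x, 𝔼 y, spike (y j (x j)) (t j) * (condRows t f (j + 1) x y * condCols t g j x y *
        if Λ * condCols t g (j + 1) x y < condCols t g j x y then 1 else 0)) * Real.log Λ ≤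
      (𝔼 x, 𝔼 y, condRows t f j x y * condCols t g j x y * Real.log (condCols t g j x y)) -
      (𝔼 x, 𝔼 y, condRows t f (j + 1) x y * condCols t g (j + 1) x y *
        Real.log (condCols t g (j + 1) x y)) +
      Fintype.card S * rectMass t f g := by
  rw [expect_condCols_eq j _ fun x y v => by rw [condCols_update_right (Nat.lt_succ_self _)],
    expect_condRows_eq j _ fun x y p => by rw [condCols_update_left le_rfl],
    ← expect_condRows_mul_condCols (j + 1 : ℕ) j.2]
  simp only [← expect_sub_distrib, mul_expect, expect_mul, ← expect_add_distrib]
  refine expect_le_expect fun x _ => expect_le_expect fun y _ => ?_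
  set A := condCols t g j x y
  set B := condCols t g (j + 1) x y with hB
  set F := condRows t f (j + 1) x y
  have hA0 : 0 ≤ A := condCols_nonneg hg _ x y
  have hB0 : 0 ≤ B := condCols_nonneg hg _ x y
  have hF0 : 0 ≤ F := condRows_nonneg hf _ x y
  have h1 : spike (y j (x j)) (t j) * (F * A * (if Λ * B < A then 1 else 0) * Real.log Λ) ≤
      spike (y j (x j)) (t j) * (F * A * Real.log A - F * A * Real.log B + F * B) := by
    refine spike_mul_le fun heq => ?_
    have hAB : 0 < A → 0 < B := by
      intro hA
      rw [hB, condCols_succ_eq_expect]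
      refine expect_pos' (fun p _ => mul_nonneg (spike_nonneg _ _) (condCols_nonneg hg _ _ _))
        ⟨y j, mem_univ _, ?_⟩
      rw [Function.update_eq_self]
      refine mul_pos ?_ hA
      rw [spike, if_pos heq]
      exact_mod_cast Fintype.card_pos
    have h2 := mul_le_mul_of_nonneg_left (log_ratio_bound hA0 hB0 hAB hΛ) hF0
    linarith
  have h2 : spike (y j (x j)) (t j) * (F * B) ≤ Fintype.card S * (F * B) :=
    mul_le_mul_of_nonneg_right (spike_le _ _) (by positivity)
  linarith

theorem expect_mul_log_nonpos {X : Type*} [Fintype X] {a z : X → ℝ} (ha : ∀ i, 0 ≤ a i)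
    (hz0 : ∀ i, 0 ≤ z i) (hz1 : ∀ i, z i ≤ 1) : 𝔼 i, a i * (z i * Real.log (z i)) ≤ 0 := by
  have h : 0 ≤ 𝔼 i, -(a i * (z i * Real.log (z i))) := expect_nonneg fun i _ => by
    have := mul_nonneg (ha i) (mul_nonneg (hz0 i)
      (neg_nonneg.2 (Real.log_nonpos (hz0 i) (hz1 i))))
    linarith
  rw [expect_neg_distrib] at h
  linarith

/-- The difference of the `f`-entropy and the `g`-entropy telescopes over the rows. At its two ends,
the fully revealed functions contribute nonpositive terms because they are at most one, and the
averaged ones contribute at most `-D log D` each by Jensen's inequality. -/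
theorem sum_growth_le (hf0 : ∀ x, 0 ≤ f x) (hf1 : ∀ x, f x ≤ 1) (hg0 : ∀ y, 0 ≤ g y)
    (hg1 : ∀ y, g y ≤ 1) (hD : 0 < rectMass t f g) {Λ : ℝ} (hΛ : 0 < Λ) :
    (∑ j : Fin K, ((𝔼 x, 𝔼 y, spike (y j (x j)) (t j) *
        (condRows t f (j + 1) x y * condCols t g j x y *
          if Λ * condRows t f j x y < condRows t f (j + 1) x y then 1 else 0)) +
      𝔼 x, 𝔼 y, spike (y j (x j)) (t j) * (condRows t f (j + 1) x y * condCols t g j x y *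
        if Λ * condCols t g (j + 1) x y < condCols t g j x y then 1 else 0))) * Real.log Λ ≤
      2 * (-(rectMass t f g * Real.log (rectMass t f g))) +
        2 * K * Fintype.card S * rectMass t f g := by
  set D := rectMass t f g
  set eF : ℕ → ℝ := fun j =>
    𝔼 x, 𝔼 y, condRows t f j x y * condCols t g j x y * Real.log (condRows t f j x y) with heF
  set eG : ℕ → ℝ := fun j =>
    𝔼 x, 𝔼 y, condRows t f j x y * condCols t g j x y * Real.log (condCols t g j x y) with heG
  have hstep : ∀ j : Fin K, ((𝔼 x, 𝔼 y, spike (y j (x j)) (t j) *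
        (condRows t f (j + 1) x y * condCols t g j x y *
          if Λ * condRows t f j x y < condRows t f (j + 1) x y then 1 else 0)) +
      𝔼 x, 𝔼 y, spike (y j (x j)) (t j) * (condRows t f (j + 1) x y * condCols t g j x y *
        if Λ * condCols t g (j + 1) x y < condCols t g j x y then 1 else 0)) * Real.log Λ ≤
      (((eF ((j : ℕ) + 1) - eG ((j : ℕ) + 1)) - (eF j - eG j)) + 2 * Fintype.card S * D) := by
    intro j
    have h1 := rows_growth_le (t := t) hf0 hg0 hΛ j
    have h2 := cols_growth_le (t := t) hf0 hg0 hΛ j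
    simp only [heF, heG]
    rw [add_mul]
    linarith
  rw [sum_mul]
  refine (sum_le_sum fun j _ => hstep j).trans ?_
  rw [sum_add_distrib, Fin.sum_univ_eq_sum_range
    (fun j => (eF (j + 1) - eG (j + 1)) - (eF j - eG j)) K,
    sum_range_sub (fun j => eF j - eG j)]
  have h1 : eF K ≤ 0 := by
    simp only [heF, condRows_last]
    rw [← expect_prod_type (fun x y => f x * condCols t g K x y * Real.log (f x))]
    refine le_of_eq_of_le (expect_congr rfl fun z _ => ?_)
      (expect_mul_log_nonpos (a := fun z : (Fin K → P) × (Fin K → P → S) => condCols t g K z.1 z.2)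
        (z := fun z => f z.1) (fun z => condCols_nonneg hg0 _ _ _) (fun z => hf0 _)
        (fun z => hf1 _))
    ring
  have h2 : eG 0 ≤ 0 := by
    simp only [heG, condCols_zero]
    rw [← expect_prod_type (fun x y => condRows t f 0 x y * g y * Real.log (g y))]
    refine le_of_eq_of_le (expect_congr rfl fun z _ => ?_)
      (expect_mul_log_nonpos (a := fun z : (Fin K → P) × (Fin K → P → S) => condRows t f 0 z.1 z.2)
        (z := fun z => g z.2) (fun z => condRows_nonneg hf0 _ _ _) (fun z => hg0 _)
        (fun z => hg1 _))
    ring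
  have h3 : -eF 0 ≤ -(D * Real.log D) := by
    have hm := expect_condRows_mul_condCols (t := t) (f := f) (g := g) 0 (Nat.zero_le _)
    rw [← expect_prod_type] at hm
    have := neg_expect_mul_log_le (a := fun z : (Fin K → P) × (Fin K → P → S) => g z.2)
      (z := fun z => condRows t f 0 z.1 z.2) (D := D) (fun z => hg0 _) (fun z => hg1 _)
      (fun z => condRows_nonneg hf0 _ _ _) hD (by
        exact Eq.trans (expect_congr rfl fun z _ => by rw [condCols_zero, mul_comm]) hm)
    refine le_of_eq_of_le ?_ this
    congr 1
    simp only [heF]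
    rw [← expect_prod_type]
    exact expect_congr rfl fun z _ => by rw [condCols_zero]; ring
  have h4 : -eG K ≤ -(D * Real.log D) := by
    have hm := expect_condRows_mul_condCols (t := t) (f := f) (g := g) K le_rfl
    rw [← expect_prod_type] at hm
    have := neg_expect_mul_log_le (a := fun z : (Fin K → P) × (Fin K → P → S) => f z.1)
      (z := fun z => condCols t g K z.1 z.2) (D := D) (fun z => hf0 _) (fun z => hf1 _)
      (fun z => condCols_nonneg hg0 _ _ _) hD (by
        exact Eq.trans (expect_congr rfl fun z _ => by rw [condRows_last]) hm)
    refine le_of_eq_of_le ?_ this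
    congr 1
    simp only [heG]
    rw [← expect_prod_type]
    exact expect_congr rfl fun z _ => by rw [condRows_last]; ring
  simp only [sum_const, card_univ, Fintype.card_fin, nsmul_eq_mul]
  linarith

/-- The entry `x j` is typical for the row `j`, given the entries of `x` before and the entries of
`y` after the row `j`. -/
def TypicalAt (t : Fin K → S) (f : (Fin K → P) → ℝ) (g : (Fin K → P → S) → ℝ) (m : ℕ) (j : Fin K)
    (x : Fin K → P) (y : Fin K → P → S) : Prop :=
  RowTypical (fun p => condRows t f (j + 1) (Function.update x j p) y)
    (fun v => condCols t g j x (Function.update y j v)) (t j) m (x j)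

/-- Conditioning row `j` on a state `σ` at `p` amounts to advancing one stage with `σ` as the target
of that row. -/
theorem rowMean_condCols (j : Fin K) (x : Fin K → P) (y : Fin K → P → S) (σ : S) (p : P) :
    rowMean (fun v => condCols t g j x (Function.update y j v)) σ p =
      condCols (Function.update t j σ) g (j + 1) (Function.update x j p) y := by
  rw [condCols_succ_eq_expect, rowMean]
  refine expect_congr rfl fun v _ => ?_
  rw [Function.update_self, Function.update_self, condCols_update_left le_rfl]
  congr 1
  refine condCols_congr_target (fun i hi => ?_) _ _
  rw [Function.update_of_ne]
  rintro rfl; omega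

theorem typicalAt_update {m : ℕ} (j : Fin K) (x : Fin K → P) (y : Fin K → P → S) (p : P)
    (v : P → S) : TypicalAt t f g m j (Function.update x j p) (Function.update y j v) ↔
      RowTypical (fun p => condRows t f (j + 1) (Function.update x j p) y)
        (fun v => condCols t g j x (Function.update y j v)) (t j) m p := by
  unfold TypicalAt
  simp only [Function.update_idem, Function.update_self, condCols_update_left le_rfl,
    condRows_update_right (Nat.lt_succ_self _)]

-- A union bound: after row `j` is resampled, the two alternatives in `rowSpread` are the growth
-- events of `f` and of `g`.
open Classical in
theorem expect_rowSpread_le (hf : ∀ x, 0 ≤ f x) (hg : ∀ y, 0 ≤ g y) (Λ : ℝ) (j : Fin K) :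
    (𝔼 x, 𝔼 y, rowSpread (fun p => condRows t f (j + 1) (Function.update x j p) y)
        (fun v => condCols t g j x (Function.update y j v)) (t j) Λ) ≤
      (𝔼 x, 𝔼 y, spike (y j (x j)) (t j) * (condRows t f (j + 1) x y * condCols t g j x y *
          if Λ * condRows t f j x y < condRows t f (j + 1) x y then 1 else 0)) +
      𝔼 x, 𝔼 y, spike (y j (x j)) (t j) * (condRows t f (j + 1) x y * condCols t g j x y *
        if Λ * condCols t g (j + 1) x y < condCols t g j x y then 1 else 0) := by
  simp only [← expect_add_distrib]
  conv_rhs => rw [← expect_resample_row j]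
  refine expect_le_expect fun x _ => expect_le_expect fun y _ => ?_
  unfold rowSpread
  refine expect_le_expect fun p _ => expect_le_expect fun v _ => ?_
  simp only [Function.update_self, condCols_update_left le_rfl,
    condRows_update_right (Nat.lt_succ_self _), condCols_update_right (Nat.lt_succ_self _)]
  have e1 : 𝔼 p', spike (v p') (t j) * condRows t f (j + 1) (Function.update x j p') y =
      condRows t f j (Function.update x j p) (Function.update y j v) := by
    rw [condRows_eq_expect]
    simp only [Function.update_self, Function.update_idem,
      condRows_update_right (Nat.lt_succ_self _)]
  have e2 := rowMean_condCols (t := t) (g := g) j x y (t j) p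
  rw [Function.update_eq_self] at e2
  rw [e1, e2]
  have h1 := spike_nonneg (v p) (t j)
  have h2 : 0 ≤ condRows t f (j + 1) (Function.update x j p) y := condRows_nonneg hf _ _ _
  have h3 : 0 ≤ condCols t g j x (Function.update y j v) := condCols_nonneg hg _ _ _
  have h4 := mul_nonneg h1 (mul_nonneg h2 h3)
  by_cases c1 : Λ * condRows t f j (Function.update x j p) (Function.update y j v) <
    condRows t f (j + 1) (Function.update x j p) y <;>
  by_cases c2 : Λ * condCols t g (j + 1) (Function.update x j p) y <
    condCols t g j x (Function.update y j v) <;> simp [c1, c2] <;> linarith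

-- The single-row estimate averaged over all other rows; `hsmall` makes the contribution of the
-- small exceptional set at most an eighth of the mass.
open Classical in
theorem expect_not_typicalAt_le (hf : ∀ x, 0 ≤ f x) (hg : ∀ y, 0 ≤ g y) {Λ : ℝ} (hΛ : 0 < Λ)
    {m : ℕ} (hm0 : 0 < m) (hm : 96 * (Fintype.card S : ℝ) ^ 3 * Λ ≤ m)
    (hsmall : 3 * m * Fintype.card S * Λ / Fintype.card P ≤ 1 / 8) (j : Fin K) :
    (𝔼 x, 𝔼 y, condRows t f (j + 1) x y * condCols t g (j + 1) x y *
        if TypicalAt t f g m j x y then 0 else 1) ≤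
      5 * (𝔼 x, 𝔼 y, rowSpread (fun p => condRows t f (j + 1) (Function.update x j p) y)
        (fun v => condCols t g j x (Function.update y j v)) (t j) Λ) +
      1 / 8 * rectMass t f g := by
  rw [← expect_condRows_mul_condCols (j + 1 : ℕ) j.2, ← expect_resample_row j,
    ← expect_resample_row j (fun x y => condRows t f (j + 1) x y * condCols t g (j + 1) x y)]
  simp only [mul_expect, ← expect_add_distrib]
  refine expect_le_expect fun x _ => expect_le_expect fun y _ => ?_
  have key := expect_not_typical_le
    (f := fun p => condRows t f (j + 1) (Function.update x j p) y)
    (g := fun v => condCols t g j x (Function.update y j v))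
    (fun p => condRows_nonneg hf _ _ _) (fun v => condCols_nonneg hg _ _ _) (t j) hΛ hm0 hm
  simp only [typicalAt_update, condRows_update_right (Nat.lt_succ_self _),
    condCols_update_right (Nat.lt_succ_self _), Fintype.expect_const]
  have e2 := fun p => rowMean_condCols (t := t) (g := g) j x y (t j) p
  simp only [Function.update_eq_self] at e2
  simp only [e2] at key
  refine key.trans (add_le_add le_rfl ?_)
  rw [← mul_expect]
  refine mul_le_mul_of_nonneg_right hsmall (expect_nonneg fun p _ => ?_)
  exact mul_nonneg (condRows_nonneg hf _ _ _) (condCols_nonneg hg _ _ _)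

open Classical in
/-- Most of the mass of a rectangle which is not tiny lies on typical entries. -/
theorem expect_not_typicalAt_le_half (hK : 0 < K) (hf0 : ∀ x, 0 ≤ f x) (hf1 : ∀ x, f x ≤ 1)
    (hg0 : ∀ y, 0 ≤ g y) (hg1 : ∀ y, g y ≤ 1) {Λ : ℝ} (hΛ : 1 < Λ)
    {m : ℕ} (hm0 : 0 < m) (hm : 96 * (Fintype.card S : ℝ) ^ 3 * Λ ≤ m)
    (hsmall : 3 * m * Fintype.card S * Λ / Fintype.card P ≤ 1 / 8)
    (hlog : 80 * (Fintype.card S : ℝ) ≤ Real.log Λ) :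
    (𝔼 j : Fin K, 𝔼 x, 𝔼 y, condRows t f (j + 1) x y * condCols t g (j + 1) x y *
        if TypicalAt t f g m j x y then 0 else 1) ≤
      1 / 2 * rectMass t f g + Real.exp (-(K * Real.log Λ / 40)) := by
  have : Nonempty (Fin K) := ⟨⟨0, hK⟩⟩
  have hKR : (0 : ℝ) < K := by exact_mod_cast hK
  have hl : 0 < Real.log Λ := Real.log_pos hΛ
  have hD0 : 0 ≤ rectMass t f g := by
    rw [← expect_condRows_mul_condCols 0 (Nat.zero_le _)]
    exact expect_nonneg fun x _ => expect_nonneg fun y _ =>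
      mul_nonneg (condRows_nonneg hf0 _ _ _) (condCols_nonneg hg0 _ _ _)
  -- A tiny rectangle is absorbed by the error term; otherwise the entropy is at most `K * log Λ /
  -- 40`.
  by_cases hD : rectMass t f g < Real.exp (-(K * Real.log Λ / 40))
  · have h1 : (𝔼 j : Fin K, 𝔼 x, 𝔼 y, condRows t f (j + 1) x y * condCols t g (j + 1) x y *
        if TypicalAt t f g m j x y then 0 else 1) ≤ 𝔼 _j : Fin K, rectMass t f g := by
      refine expect_le_expect fun j _ => ?_
      rw [← expect_condRows_mul_condCols (j + 1 : ℕ) j.2]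
      refine expect_le_expect fun x _ => expect_le_expect fun y _ => ?_
      have := mul_nonneg (condRows_nonneg (t := t) hf0 (j + 1) x y)
        (condCols_nonneg (t := t) hg0 (j + 1) x y)
      split_ifs <;> simp [this]
    rw [Fintype.expect_const] at h1
    linarith
  push Not at hD
  have hDpos : 0 < rectMass t f g := (Real.exp_pos _).trans_le hD
  set D := rectMass t f g with hDdef
  have hlogD : -Real.log D ≤ K * Real.log Λ / 40 := by
    have := Real.log_le_log (Real.exp_pos _) hD
    rw [Real.log_exp] at this
    linarith
  have h1 : (𝔼 j : Fin K, 𝔼 x, 𝔼 y, condRows t f (j + 1) x y * condCols t g (j + 1) x y *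
        if TypicalAt t f g m j x y then 0 else 1) ≤ 5 * (𝔼 j : Fin K, 𝔼 x, 𝔼 y,
      rowSpread (fun p => condRows t f (j + 1) (Function.update x j p) y)
        (fun v => condCols t g j x (Function.update y j v)) (t j) Λ) + 1 / 8 * D := by
    refine (expect_le_expect fun j _ => expect_not_typicalAt_le hf0 hg0 (by linarith) hm0 hm
      hsmall j).trans ?_
    rw [expect_add_distrib, ← mul_expect, Fintype.expect_const]
  have h2 := (sum_le_sum fun j (_ : j ∈ univ) =>
    expect_rowSpread_le (t := t) hf0 hg0 Λ j)
  have h3 := (mul_le_mul_of_nonneg_right h2 hl.le).trans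
    (sum_growth_le hf0 hf1 hg0 hg1 hDpos (by linarith))
  rw [Fintype.expect_eq_sum_div_card, Fintype.card_fin] at h1
  rw [Fintype.expect_eq_sum_div_card, Fintype.card_fin]
  set X := ∑ j : Fin K, 𝔼 x, 𝔼 y,
      rowSpread (fun p => condRows t f (j + 1) (Function.update x j p) y)
        (fun v => condCols t g j x (Function.update y j v)) (t j) Λ
  rw [Fintype.expect_eq_sum_div_card, Fintype.card_fin] at h1
  refine h1.trans ?_
  -- The entropy gives `2 / 40` and the linear error `2 / 80`, in total `3 / 40`; five times this
  -- plus `1 / 8` is the claimed `1 / 2`.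
  have h4 : X * Real.log Λ ≤ (3 / 40 * K * D) * Real.log Λ := by
    have e1 : -(D * Real.log D) ≤ D * (K * Real.log Λ / 40) := by
      have := mul_le_mul_of_nonneg_left hlogD hD0
      linarith
    have e2 : 2 * K * (Fintype.card S : ℝ) * D ≤ 2 * K * (Real.log Λ / 80) * D := by
      have : (Fintype.card S : ℝ) ≤ Real.log Λ / 80 := by linarith
      gcongr
    linarith
  have h5 : X / K ≤ 3 / 40 * D := by
    rw [div_le_iff₀ hKR]
    have := le_of_mul_le_mul_right h4 hl
    linarith
  have := Real.exp_pos (-(K * Real.log Λ / 40))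
  linarith

end Entropy

/-! ### Oddtown and the weights of triples -/

section Oddtown

/-- Triples whose pairwise intersections never have exactly one element form an oddtown family. -/
theorem card_le_of_inter_card_ne_one {α : Type*} [Fintype α] [DecidableEq α]
    (G : Finset (Finset α)) (h3 : ∀ F ∈ G, #F = 3) (h1 : ∀ F ∈ G, ∀ F' ∈ G, #(F ∩ F') ≠ 1) :
    #G ≤ Fintype.card α := by
  classical
  let M : Matrix G α (ZMod 2) := Matrix.of fun F a => if a ∈ F.1 then 1 else 0
  -- Modulo two the incidence vectors are orthonormal: triples have odd size, and distinct ones meet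
  -- in zero or two elements.
  have hM : M * M.transpose = 1 := by
    ext F F'
    have e : (M * M.transpose) F F' = (#(F.1 ∩ F'.1) : ZMod 2) := by
      rw [Matrix.mul_apply]
      simp only [M, Matrix.of_apply, Matrix.transpose_apply, ← ite_and, mul_ite, mul_one, mul_zero]
      rw [sum_boole]
      congr 2
      ext a
      simp [and_comm]
    rw [e, Matrix.one_apply]
    split_ifs with hF
    · subst hF
      rw [inter_self, h3 _ F.2]
      rfl
    · have hlt : #(F.1 ∩ F'.1) < 3 := by
        by_contra! hcon
        have s1 : F.1 ∩ F'.1 = F.1 :=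
          eq_of_subset_of_card_le inter_subset_left (by rw [h3 _ F.2]; exact hcon)
        have s2 : F.1 ∩ F'.1 = F'.1 :=
          eq_of_subset_of_card_le inter_subset_right (by rw [h3 _ F'.2]; exact hcon)
        exact hF (Subtype.ext (s1.symm.trans s2))
      have hne := h1 _ F.2 _ F'.2
      have : #(F.1 ∩ F'.1) = 0 ∨ #(F.1 ∩ F'.1) = 2 := by omega
      rcases this with h | h <;> rw [h] <;> rfl
  have h5 : (M * M.transpose).rank ≤ M.rank := Matrix.rank_mul_le_left _ _
  rw [hM, Matrix.rank_one] at h5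
  have h6 := M.rank_le_card_width
  have h7 : Fintype.card G = #G := Fintype.card_coe G
  omega

-- Call a good triple heavy if its weight is at least `c / k²`. Light triples contribute at most `#T
-- * c / k²`. If no two heavy triples meet in one element, oddtown leaves at most `k` of them, each
-- of weight at most `2 * c`. Otherwise one such pair makes the double sum at least `c / k²`, and
-- this pays for the trivial bound `2 * c * #T`.
open Classical in
theorem sum_le_of_good {α : Type*} [Fintype α] [DecidableEq α] [Nonempty α]
    (T : Finset (Finset α)) (h3 : ∀ F ∈ T, #F = 3) {b : Finset α → ℝ} {c : ℝ}
    {good : Finset α → Prop} (hb : ∀ F, 0 ≤ b F) (hc : 0 ≤ c)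
    (hgood : ∀ F, good F → b F / 2 ≤ c) :
    ∑ F ∈ T, b F ≤ (∑ F ∈ T, b F * if good F then 0 else 1) +
      (2 * Fintype.card α + #T / (Fintype.card α : ℝ) ^ 2) * c +
      2 * #T * (Fintype.card α : ℝ) ^ 2 * ∑ F ∈ T, ∑ F' ∈ T,
        if #(F ∩ F') = 1 then (if good F then 1 else 0) * ((if good F' then 1 else 0) * b F')
        else 0 := by
  set k : ℝ := (Fintype.card α : ℝ) with hk
  have hk0 : 0 < k := by rw [hk]; exact_mod_cast Fintype.card_pos
  set term : Finset α → Finset α → ℝ := fun F F' =>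
    if #(F ∩ F') = 1 then (if good F then 1 else 0) * ((if good F' then 1 else 0) * b F') else 0
    with hterm
  have hterm0 : ∀ F F', 0 ≤ term F F' := by
    intro F F'
    have := hb F'
    simp only [hterm]
    split_ifs <;> simp [this]
  have hpair0 : 0 ≤ ∑ F ∈ T, ∑ F' ∈ T, term F F' :=
    sum_nonneg fun F _ => sum_nonneg fun F' _ => hterm0 F F'
  have hsplit : ∑ F ∈ T, b F = (∑ F ∈ T, b F * if good F then 0 else 1) +
      ∑ F ∈ T with good F, b F := by
    rw [sum_filter, ← sum_add_distrib]
    refine sum_congr rfl fun F _ => ?_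
    split_ifs <;> simp
  have hN : (0 : ℝ) ≤ #T := by positivity
  suffices h : ∑ F ∈ T with good F, b F ≤ (2 * k + #T / k ^ 2) * c +
      2 * #T * k ^ 2 * ∑ F ∈ T, ∑ F' ∈ T, term F F' by
    rw [hsplit]; linarith
  set G := (T.filter good).filter fun F => c / k ^ 2 ≤ b F with hG
  have hGT : ∀ F ∈ G, F ∈ T ∧ good F ∧ c / k ^ 2 ≤ b F := by
    intro F hF
    simp only [hG, mem_filter] at hF
    exact ⟨hF.1.1, hF.1.2, hF.2⟩
  by_cases hcase : ∀ F ∈ G, ∀ F' ∈ G, #(F ∩ F') ≠ 1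
  · have hcard := card_le_of_inter_card_ne_one G (fun F hF => h3 F (hGT F hF).1) hcase
    have hcardR : (#G : ℝ) ≤ k := by rw [hk]; exact_mod_cast hcard
    have h1 : ∑ F ∈ G, b F ≤ 2 * k * c := by
      calc ∑ F ∈ G, b F ≤ ∑ F ∈ G, 2 * c := sum_le_sum fun F hF => by
            have := hgood F (hGT F hF).2.1; linarith
        _ = #G * (2 * c) := by rw [sum_const, nsmul_eq_mul]
        _ ≤ k * (2 * c) := by gcongr
        _ = _ := by ring
    have h2 : ∑ F ∈ T.filter good with ¬ c / k ^ 2 ≤ b F, b F ≤ #T / k ^ 2 * c := by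
      calc ∑ F ∈ T.filter good with ¬ c / k ^ 2 ≤ b F, b F
          ≤ ∑ F ∈ T.filter good with ¬ c / k ^ 2 ≤ b F, c / k ^ 2 := sum_le_sum fun F hF =>
            (not_le.1 (mem_filter.1 hF).2).le
        _ ≤ ∑ F ∈ T, c / k ^ 2 := sum_le_sum_of_subset_of_nonneg
            ((filter_subset _ _).trans (filter_subset _ _)) fun _ _ _ => by positivity
        _ = _ := by rw [sum_const, nsmul_eq_mul]; ring
    rw [← sum_filter_add_sum_filter_not (T.filter good) fun F => c / k ^ 2 ≤ b F]
    have : 0 ≤ 2 * #T * k ^ 2 * ∑ F ∈ T, ∑ F' ∈ T, term F F' := by positivity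
    linarith
  · push Not at hcase
    obtain ⟨F, hF, F', hF', hFF'⟩ := hcase
    have h1 : ∑ F ∈ T with good F, b F ≤ #T * (2 * c) := by
      calc ∑ F ∈ T with good F, b F ≤ ∑ F ∈ T with good F, 2 * c := sum_le_sum fun F hF => by
            have := hgood F (mem_filter.1 hF).2; linarith
        _ ≤ ∑ F ∈ T, 2 * c := sum_le_sum_of_subset_of_nonneg (filter_subset _ _)
            fun _ _ _ => by positivity
        _ = _ := by rw [sum_const, nsmul_eq_mul]
    have h2 : b F' ≤ ∑ F ∈ T, ∑ F' ∈ T, term F F' := by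
      have e : term F F' = b F' := by
        simp [hterm, hFF', (hGT F hF).2.1, (hGT F' hF').2.1]
      rw [← e]
      refine (single_le_sum (f := fun F' => term F F') (fun F' _ => hterm0 F F')
        (hGT F' hF').1).trans ?_
      exact single_le_sum (f := fun F => ∑ F' ∈ T, term F F')
        (fun F _ => sum_nonneg fun F' _ => hterm0 F F') (hGT F hF).1
    have h3 : c ≤ k ^ 2 * ∑ F ∈ T, ∑ F' ∈ T, term F F' := by
      have := (hGT F' hF').2.2.trans h2
      rw [div_le_iff₀ (by positivity)] at this
      linarith
    have h4 : #T * (2 * c) ≤ 2 * #T * k ^ 2 * ∑ F ∈ T, ∑ F' ∈ T, term F F' := by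
      have := mul_le_mul_of_nonneg_left h3 (show (0 : ℝ) ≤ 2 * #T by positivity)
      linarith
    have : 0 ≤ (2 * k + #T / k ^ 2) * c := by positivity
    linarith

end Oddtown

/-! ### The ground set, its pairings and permutations of a core -/

section Gadget

open Equiv

/-- The vertices of a block, in pairs. -/
abbrev Block (q : ℕ) : Type := Fin q × Bool

/-- The involutions of a block. -/
abbrev BlockState (q : ℕ) : Type := {σ : Perm (Block q) // σ * σ = 1}

/-- Three special elements together with one block. -/
abbrev Core (q : ℕ) : Type := Fin 3 ⊕ Block q

/-- Three special elements, a `K` by `P` array of blocks, and `r` spare elements. -/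
abbrev Ground (K : ℕ) (P : Type) (q r : ℕ) : Type := Fin 3 ⊕ (Fin K × P × Block q) ⊕ Fin r

instance (q : ℕ) : Fintype (BlockState q) := inferInstance

instance (q : ℕ) : Nonempty (BlockState q) := ⟨⟨1, one_mul 1⟩⟩

/-- The trivial involution. -/
def idState (q : ℕ) : BlockState q := ⟨1, one_mul 1⟩

/-- The fixed-point-free involution of a block. -/
def flipState (q : ℕ) : BlockState q :=
  ⟨Equiv.prodCongr 1 Equiv.boolNot, by ext ⟨a, b⟩ <;> simp⟩

theorem BlockState.apply_apply {q : ℕ} (σ : BlockState q) (a : Block q) : σ.1 (σ.1 a) = a := by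
  rw [← Perm.mul_apply, σ.2, Perm.one_apply]

theorem flipState_ne_idState {q : ℕ} (hq : 2 ≤ q) : flipState q ≠ idState q := by
  intro h
  have h1 := congrArg (fun σ : BlockState q => σ.1 (⟨0, by omega⟩, true)) h
  simp [flipState, idState] at h1

variable {K q r : ℕ} {P : Type} [Fintype P] [DecidableEq P]

instance : DecidableEq (Ground K P q r) := inferInstance

set_option synthInstance.maxSize 1000 in
instance : Fintype (Perm (Ground K P q r)) := inferInstance

/-- The special elements and, in each row `i` of the array, the block `x i`. -/
def rowSet (x : Fin K → P) : Finset (Ground K P q r) :=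
  univ.filter fun z => Sum.elim (fun _ => true)
    (Sum.elim (fun w : Fin K × P × Block q => decide (w.2.1 = x w.1)) fun _ => false) z = true

@[simp] theorem inl_mem_rowSet (x : Fin K → P) (a : Fin 3) :
    (Sum.inl a : Ground K P q r) ∈ rowSet x := by simp [rowSet]

@[simp] theorem block_mem_rowSet (x : Fin K → P) (w : Fin K × P × Block q) :
    (Sum.inr (Sum.inl w) : Ground K P q r) ∈ rowSet x ↔ w.2.1 = x w.1 := by simp [rowSet]

@[simp] theorem spare_notMem_rowSet (x : Fin K → P) (c : Fin r) :
    (Sum.inr (Sum.inr c) : Ground K P q r) ∉ rowSet x := by simp [rowSet]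

/-- The involution acting by `s` on the special elements and by `y i p` on the block `(i, p)`. -/
def pairing (s : Perm (Fin 3)) (y : Fin K → P → BlockState q) : Perm (Ground K P q r) :=
  Equiv.sumCongr s (Equiv.sumCongr (Function.Involutive.toPerm
    (fun w : Fin K × P × Block q => (w.1, w.2.1, (y w.1 w.2.1).1 w.2.2))
    fun w => by simp [BlockState.apply_apply]) 1)

@[simp] theorem pairing_inl (s : Perm (Fin 3)) (y : Fin K → P → BlockState q) (a : Fin 3) :
    (pairing s y : Perm (Ground K P q r)) (Sum.inl a) = Sum.inl (s a) := rfl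

@[simp] theorem pairing_block (s : Perm (Fin 3)) (y : Fin K → P → BlockState q) (i : Fin K)
    (p : P) (b : Block q) : (pairing s y : Perm (Ground K P q r)) (Sum.inr (Sum.inl (i, p, b))) =
      Sum.inr (Sum.inl (i, p, (y i p).1 b)) := rfl

@[simp] theorem pairing_spare (s : Perm (Fin 3)) (y : Fin K → P → BlockState q) (c : Fin r) :
    (pairing s y : Perm (Ground K P q r)) (Sum.inr (Sum.inr c)) = Sum.inr (Sum.inr c) := rfl

/-- The embedding of the core as the special elements and the block `(j, p)`. -/
def coreEmbedding (j : Fin K) (p : P) : Core q ↪ Ground K P q r where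
  toFun := Sum.elim Sum.inl fun b => Sum.inr (Sum.inl (j, p, b))
  inj' := by
    rintro (a | a) (b | b) h <;> simp_all

@[simp] theorem coreEmbedding_inl (j : Fin K) (p : P) (a : Fin 3) :
    (coreEmbedding j p (Sum.inl a : Core q) : Ground K P q r) = Sum.inl a := rfl

@[simp] theorem coreEmbedding_inr (j : Fin K) (p : P) (b : Block q) :
    (coreEmbedding j p (Sum.inr b : Core q) : Ground K P q r) = Sum.inr (Sum.inl (j, p, b)) := rfl

/-- The permutation of the ground set acting by `ρ` on the special elements and the block
`(j, p)`. -/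
noncomputable def coreLift (j : Fin K) (p : P) (ρ : Perm (Core q)) : Perm (Ground K P q r) :=
  ρ.viaEmbedding (coreEmbedding j p)

theorem coreLift_mul (j : Fin K) (p : P) (ρ ρ' : Perm (Core q)) :
    (coreLift j p (ρ * ρ') : Perm (Ground K P q r)) = coreLift j p ρ * coreLift j p ρ' :=
  map_mul (Perm.viaEmbeddingHom (coreEmbedding (r := r) j p)) ρ ρ'

theorem coreLift_inv (j : Fin K) (p : P) (ρ : Perm (Core q)) :
    (coreLift j p ρ⁻¹ : Perm (Ground K P q r)) = (coreLift j p ρ)⁻¹ :=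
  map_inv (Perm.viaEmbeddingHom (coreEmbedding (r := r) j p)) ρ

theorem coreLift_apply (j : Fin K) (p : P) (ρ : Perm (Core q)) (c : Core q) :
    (coreLift j p ρ : Perm (Ground K P q r)) (coreEmbedding j p c) = coreEmbedding j p (ρ c) :=
  Perm.viaEmbedding_apply _ _ _

theorem coreLift_apply_of_notMem {j : Fin K} {p : P} (ρ : Perm (Core q)) {z : Ground K P q r}
    (hz : z ∉ Set.range (coreEmbedding (q := q) (r := r) j p)) : coreLift j p ρ z = z :=
  Perm.viaEmbedding_apply_of_notMem _ _ _ hz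

/-- The core at `(j, x j)` lies inside the row set, so permuting it is invisible to functions of
sets. -/
theorem rowSet_map_coreLift {j : Fin K} {x : Fin K → P} (ρ : Perm (Core q)) :
    (rowSet x).map (coreLift (r := r) j (x j) ρ).toEmbedding = rowSet x := by
  have hmem : ∀ z : Ground K P q r, z ∈ rowSet x ↔ coreLift j (x j) ρ z ∈ rowSet x := by
    intro z
    by_cases hz : z ∈ Set.range (coreEmbedding (q := q) (r := r) j (x j))
    · obtain ⟨c, rfl⟩ := hz
      rw [coreLift_apply]
      have h : ∀ c : Core q, (coreEmbedding j (x j) c : Ground K P q r) ∈ rowSet x := by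
        rintro (c | c) <;> simp
      simp [h]
    · rw [coreLift_apply_of_notMem ρ hz]
  ext z
  rw [mem_map_equiv, hmem]
  simp

/-- Separates the action on the core from a pairing that fixes the core pointwise and hence commutes
with every permutation of it. -/
theorem pairing_eq_coreLift_mul (s : Perm (Fin 3)) (y : Fin K → P → BlockState q) (j : Fin K)
    (p : P) : (pairing s y : Perm (Ground K P q r)) =
      coreLift j p (Equiv.sumCongr s (y j p).1) *
        pairing 1 (Function.update y j (Function.update (y j) p (idState q))) := by
  ext1 z
  rw [Perm.mul_apply]
  rcases z with a | ⟨i, p', b⟩ | c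
  · have h : (pairing 1 (Function.update y j (Function.update (y j) p (idState q))) :
        Perm (Ground K P q r)) (Sum.inl a) = coreEmbedding j p (Sum.inl a) := by
      simp
    rw [h, coreLift_apply]
    simp
  · by_cases hip : i = j ∧ p' = p
    · obtain ⟨rfl, rfl⟩ := hip
      have h : (pairing 1 (Function.update y i (Function.update (y i) p' (idState q))) :
          Perm (Ground K P q r)) (Sum.inr (Sum.inl (i, p', b))) =
          coreEmbedding i p' (Sum.inr b) := by
        simp [idState]
      rw [h, coreLift_apply]
      simp
    · have hy : Function.update y j (Function.update (y j) p (idState q)) i p' = y i p' := by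
        by_cases hi : i = j
        · subst hi
          rw [Function.update_self, Function.update_of_ne (by tauto)]
        · rw [Function.update_of_ne hi]
      rw [coreLift_apply_of_notMem]
      · simp [hy]
      · rintro ⟨c | c, hc⟩ <;> simp at hc
        tauto
  · rw [coreLift_apply_of_notMem]
    · simp
    · rintro ⟨c | c, hc⟩ <;> simp at hc

theorem coreLift_commute_pairing {y : Fin K → P → BlockState q} {j : Fin K} {p : P}
    (hy : y j p = idState q) (ρ : Perm (Core q)) :
    Commute (coreLift j p ρ) (pairing 1 y : Perm (Ground K P q r)) := by
  have hfix : ∀ c : Core q, (pairing 1 y : Perm (Ground K P q r)) (coreEmbedding j p c) =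
      coreEmbedding j p c := by
    rintro (c | c)
    · simp
    · simp [hy, idState]
  ext1 z
  rw [Perm.mul_apply, Perm.mul_apply]
  by_cases hz : z ∈ Set.range (coreEmbedding (q := q) (r := r) j p)
  · obtain ⟨c, rfl⟩ := hz
    rw [hfix, coreLift_apply, hfix]
  · rw [coreLift_apply_of_notMem ρ hz, coreLift_apply_of_notMem]
    rintro ⟨c, hc⟩
    rw [← hfix c] at hc
    exact hz ⟨c, (pairing 1 y).injective hc⟩

/-- The conjugate of a pairing only depends on the involution it induces on the core. -/
theorem conj_pairing_eq {y : Fin K → P → BlockState q} {j : Fin K} {p : P} {s : Perm (Fin 3)}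
    {κ : Perm (Core q)}
    (hκ : κ * Equiv.sumCongr 1 (y j p).1 * κ⁻¹ = Equiv.sumCongr s 1) :
    coreLift j p κ * (pairing 1 y : Perm (Ground K P q r)) * (coreLift j p κ)⁻¹ =
      pairing s (Function.update y j (Function.update (y j) p (idState q))) := by
  have h1 := pairing_eq_coreLift_mul (r := r) 1 y j p
  have h2 := pairing_eq_coreLift_mul (r := r) s
    (Function.update y j (Function.update (y j) p (idState q))) j p
  simp only [Function.update_self, Function.update_idem] at h2
  have hc := coreLift_commute_pairing (r := r)
    (y := Function.update y j (Function.update (y j) p (idState q))) (j := j) (p := p)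
    (by simp) κ⁻¹
  rw [h1, h2, ← coreLift_inv, mul_assoc, mul_assoc, ← hc.eq, ← mul_assoc, ← mul_assoc,
    ← coreLift_mul, ← coreLift_mul, hκ]
  rfl

end Gadget

/-! ### Changing the view of a core -/

section Views

open Equiv

variable {K q r : ℕ} {P : Type} [Fintype P] [DecidableEq P] [Nonempty P]

theorem rowMean_eq_expect {S : Type*} [Fintype S] [DecidableEq S] [Nonempty S]
    (G : (P → S) → ℝ) (σ : S) (p : P) : rowMean G σ p = 𝔼 v, G (Function.update v p σ) := by
  rw [rowMean, ← expect_update p]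
  refine expect_congr rfl fun v _ => ?_
  simp only [Function.update_self]
  exact expect_spike_mul σ fun a => G (Function.update v p a)

theorem rowMean₂_eq_expect {S : Type*} [Fintype S] [DecidableEq S] [Nonempty S]
    (G : (P → S) → ℝ) (σ τ : S) {p p' : P} (h : p' ≠ p) :
    rowMean₂ G σ τ p p' = 𝔼 v : P → S, spike (v p') τ * G (Function.update v p σ) := by
  have := rowMean_eq_expect (fun v => spike (v p') τ * G v) σ p
  simp only [Function.update_of_ne h] at this
  rw [← this, rowMean₂, rowMean, rowMean]
  exact expect_congr rfl fun v _ => by ring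

theorem rowMean₂_self {S : Type*} [Fintype S] [DecidableEq S] [Nonempty S]
    (G : (P → S) → ℝ) {σ τ : S} (h : σ ≠ τ) (p : P) : rowMean₂ G σ τ p p = 0 := by
  refine expect_eq_zero fun v _ => ?_
  unfold spike
  by_cases h1 : v p = τ
  · simp [h1, h.symm]
  · simp [h1]

/-- A function of sets, seen on the sets `rowSet x` through a permutation of the ground set. -/
def rowView (f : Finset (Ground K P q r) → ℝ) (π : Perm (Ground K P q r)) (x : Fin K → P) : ℝ :=
  f ((rowSet x).map π.toEmbedding)

/-- A function of permutations, seen on the pairings through a permutation of the ground set. -/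
def colView (g : Perm (Ground K P q r) → ℝ) (π : Perm (Ground K P q r)) (s : Perm (Fin 3))
    (y : Fin K → P → BlockState q) : ℝ :=
  g (π * pairing s y * π⁻¹)

variable {f : Finset (Ground K P q r) → ℝ} {g : Perm (Ground K P q r) → ℝ}

theorem condRows_view_eq (t : Fin K → BlockState q) (π : Perm (Ground K P q r)) (j : Fin K)
    (ρ : Perm (Core q)) (x : Fin K → P) (y) :
    condRows t (rowView f (π * coreLift j (x j) ρ)) (j + 1) x y =
      condRows t (rowView f π) (j + 1) x y := by
  unfold condRows
  refine expect_congr rfl fun x' _ => ?_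
  congr 1
  unfold rowView
  congr 1
  set x'' : Fin K → P := fun i => if (i : ℕ) < j + 1 then x i else x' i with hx''
  have hxj : x'' j = x j := by simp [hx'']
  have e : (π * coreLift j (x j) ρ).toEmbedding =
      (coreLift j (x j) ρ).toEmbedding.trans π.toEmbedding := rfl
  rw [e, ← map_map, ← hxj, rowSet_map_coreLift]

/-- An involution `τ` of the block, seen after moving the core by `κ`, is the action `s` on the
special elements with the block left fixed, seen before the move. The rest of the pairing is
untouched. -/
theorem condCols_view_eq (t : Fin K → BlockState q) (π : Perm (Ground K P q r)) (j : Fin K)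
    (p : P) {s : Perm (Fin 3)} {τ : BlockState q} {κ : Perm (Core q)}
    (hκ : κ * Equiv.sumCongr 1 τ.1 * κ⁻¹ = Equiv.sumCongr s 1) (x : Fin K → P) (y)
    (v : P → BlockState q) :
    condCols t (colView g (π * coreLift j p κ) 1) j x
        (Function.update y j (Function.update v p τ)) =
      condCols t (colView g π s) j x (Function.update y j (Function.update v p (idState q))) := by
  unfold condCols
  refine expect_congr rfl fun y' _ => ?_
  congr 1
  unfold colView
  set y'' : Fin K → P → BlockState q := fun i => if (i : ℕ) < j then y' i else
    Function.update y j (Function.update v p τ) i with hy''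
  have hyj : y'' j = Function.update v p τ := by simp [hy'']
  have h := conj_pairing_eq (r := r) (y := y'') (j := j) (p := p) (s := s) (κ := κ)
    (by rw [hyj, Function.update_self]; exact hκ)
  have e : Function.update y'' j (Function.update (y'' j) p (idState q)) =
      fun i : Fin K => if (i : ℕ) < j then y' i else
        Function.update y j (Function.update v p (idState q)) i := by
    funext i
    by_cases hi : i = j
    · subst hi
      simp [hyj]
    · simp [hy'', Function.update_of_ne hi]
  rw [← e, ← h]
  simp only [mul_inv_rev, mul_assoc]

theorem rowMean_view_eq (t : Fin K → BlockState q) (π : Perm (Ground K P q r)) (j : Fin K)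
    (p : P) {s : Perm (Fin 3)} {τ : BlockState q} {κ : Perm (Core q)}
    (hκ : κ * Equiv.sumCongr 1 τ.1 * κ⁻¹ = Equiv.sumCongr s 1) (x : Fin K → P) (y) :
    rowMean (fun v => condCols t (colView g (π * coreLift j p κ) 1) j x (Function.update y j v))
        τ p =
      rowMean (fun v => condCols t (colView g π s) j x (Function.update y j v)) (idState q) p := by
  rw [rowMean_eq_expect, rowMean_eq_expect]
  exact expect_congr rfl fun v _ => condCols_view_eq t π j p hκ x y v

/-- For `p' = p` the two conditions on the block contradict each other in both views, so both sides
vanish; this is where `hτ` and `ho` enter. -/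
theorem rowMean₂_view_eq (t : Fin K → BlockState q) (π : Perm (Ground K P q r)) (j : Fin K)
    (p p' : P) {s : Perm (Fin 3)} {τ o : BlockState q} {κ : Perm (Core q)}
    (hκ : κ * Equiv.sumCongr 1 τ.1 * κ⁻¹ = Equiv.sumCongr s 1) (hτ : τ ≠ o) (ho : idState q ≠ o)
    (x : Fin K → P) (y) :
    rowMean₂ (fun v => condCols t (colView g (π * coreLift j p κ) 1) j x (Function.update y j v))
        τ o p p' =
      rowMean₂ (fun v => condCols t (colView g π s) j x (Function.update y j v))
        (idState q) o p p' := by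
  by_cases hp : p' = p
  · subst hp
    rw [rowMean₂_self _ hτ, rowMean₂_self _ ho]
  · rw [rowMean₂_eq_expect _ _ _ hp, rowMean₂_eq_expect _ _ _ hp]
    exact expect_congr rfl fun v _ => by rw [condCols_view_eq t π j p hκ x y v]

theorem expect_resample_entry {S : Type*} [Fintype S] [Nonempty S] (j : Fin K)
    (Φ : (Fin K → P) → (Fin K → P → S) → ℝ) :
    𝔼 x, 𝔼 y, 𝔼 p, Φ (Function.update x j p) y = 𝔼 x, 𝔼 y, Φ x y := by
  rw [← expect_update j (fun x => 𝔼 y, Φ x y)]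
  exact expect_congr rfl fun x _ => expect_comm _ _ _

theorem typicalAt_update_left {S : Type*} [Fintype S] [DecidableEq S] [Nonempty S]
    {t : Fin K → S} {f : (Fin K → P) → ℝ} {g : (Fin K → P → S) → ℝ} {m : ℕ} (j : Fin K)
    (x : Fin K → P) (y : Fin K → P → S) (p : P) :
    TypicalAt t f g m j (Function.update x j p) y ↔
      RowTypical (fun p => condRows t f (j + 1) (Function.update x j p) y)
        (fun v => condCols t g j x (Function.update y j v)) (t j) m p := by
  have := typicalAt_update (t := t) (f := f) (g := g) (m := m) j x y p (y j)
  rwa [Function.update_eq_self] at this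

open Classical in
/-- Two typical views of the same core whose sets of special elements meet in one element force
mass on the pairs which are cut once. -/
theorem expect_typical_pair_le (hf : ∀ u, 0 ≤ f u) (hg : ∀ ι, 0 ≤ g ι) {m : ℕ} (hm : 0 < m)
    {t : Fin K → BlockState q} (π : Perm (Ground K P q r)) (j : Fin K) {s : Perm (Fin 3)}
    {τ : BlockState q} {κ : Perm (Core q)}
    (hκ : κ * Equiv.sumCongr 1 τ.1 * κ⁻¹ = Equiv.sumCongr s 1) (hτ : τ ≠ t j)
    (ho : idState q ≠ t j) :
    (𝔼 x, 𝔼 y, condRows t (rowView f π) (j + 1) x y *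
      ((if TypicalAt t (rowView f π) (colView g π 1) m j x y then 1 else 0) *
        ((if TypicalAt t (rowView f (π * coreLift j (x j) κ))
            (colView g (π * coreLift j (x j) κ) 1) m j x y then 1 else 0) *
          condCols t (colView g (π * coreLift j (x j) κ) 1) (j + 1) x y))) ≤
      4 * Fintype.card (BlockState q) * rectMass t (rowView f π) (colView g π s) := by
  have hf' : ∀ π x, 0 ≤ rowView f π x := fun π x => hf _
  have hg' : ∀ π s y, 0 ≤ colView g π s y := fun π s y => hg _
  rw [← expect_condRows_mul_condCols (j + 1 : ℕ) j.2, ← expect_resample_entry j,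
    ← expect_resample_entry j (fun x y => condRows t (rowView f π) (j + 1) x y *
      condCols t (colView g π s) (j + 1) x y)]
  simp only [mul_expect]
  refine expect_le_expect fun x _ => expect_le_expect fun y _ => ?_
  rw [← mul_expect]
  simp only [Function.update_self, typicalAt_update_left]
  rw [Fintype.expect_eq_sum_div_card, Fintype.expect_eq_sum_div_card, ← mul_div_assoc]
  refine div_le_div_of_nonneg_right ?_ (by positivity)
  set b : P → ℝ := fun p =>
    (if RowTypical (fun p => condRows t (rowView f π) (j + 1) (Function.update x j p) y)
        (fun v => condCols t (colView g π 1) j x (Function.update y j v)) (t j) m p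
      then 1 else 0) *
    ((if RowTypical (fun p' => condRows t (rowView f (π * coreLift j p κ)) (j + 1)
          (Function.update x j p') y)
        (fun v => condCols t (colView g (π * coreLift j p κ) 1) j x (Function.update y j v))
        (t j) m p then 1 else 0) *
      condCols t (colView g (π * coreLift j p κ) 1) (j + 1) (Function.update x j p) y) with hb
  have hb0 : ∀ p, 0 ≤ b p := by
    intro p
    have := condCols_nonneg (t := t) (hg' (π * coreLift j p κ) 1) (j + 1) (Function.update x j p) y
    simp only [hb]
    split_ifs <;> simp [this]
  have hpos : ∀ p, 0 < b p →
      RowTypical (fun p => condRows t (rowView f π) (j + 1) (Function.update x j p) y)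
        (fun v => condCols t (colView g π 1) j x (Function.update y j v)) (t j) m p ∧
      RowTypical (fun p' => condRows t (rowView f (π * coreLift j p κ)) (j + 1)
          (Function.update x j p') y)
        (fun v => condCols t (colView g (π * coreLift j p κ) 1) j x (Function.update y j v))
        (t j) m p ∧
      b p = condCols t (colView g (π * coreLift j p κ) 1) (j + 1) (Function.update x j p) y := by
    intro p hp
    simp only [hb] at hp ⊢
    split_ifs at hp ⊢ with h1 h2
    · exact ⟨h1, h2, by simp⟩
    all_goals simp at hp
  -- Mass moves from the block `p`, now fixed pointwise, to a flipped block `p'` of the same row.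
  -- Typicality of the second view bounds the number of bad `p'`; typicality of the first gives
  -- enough `p'` at which `f` is no smaller.
  refine sum_mul_le_of_layers (m := m) hm (fun p => condRows_nonneg (hf' π) _ _ _) hb0
    (φ := fun p p' => rowMean₂ (fun v => condCols t (colView g π s) j x (Function.update y j v))
        (idState q) (t j) p p') ?_ ?_ ?_ ?_
  · intro p p'
    exact rowMean_nonneg (fun v => mul_nonneg (spike_nonneg _ _) (condCols_nonneg (hg' _ _) _ _ _))
      _ _
  · intro p hp W hW
    obtain ⟨_, h2, h3⟩ := hpos p hp
    refine h2.2.1 τ W fun p' hp' => ?_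
    rw [rowMean₂_view_eq t π j p p' hκ hτ ho, rowMean_condCols, Function.update_eq_self, ← h3]
    exact hW p' hp'
  · intro p' W
    have e := rowMean_condCols (t := t) (g := colView g π s) j x y (t j) p'
    rw [Function.update_eq_self] at e
    rw [← e]
    unfold rowMean₂ rowMean
    rw [← expect_sum_comm, mul_expect]
    refine expect_le_expect fun v _ => ?_
    have h1 : ∑ p ∈ W, spike (v p) (idState q) ≤ #W * Fintype.card (BlockState q) := by
      rw [← nsmul_eq_mul, ← sum_const]
      exact sum_le_sum fun p _ => spike_le _ _
    have h2 : 0 ≤ spike (v p') (t j) * condCols t (colView g π s) j x (Function.update y j v) :=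
      mul_nonneg (spike_nonneg _ _) (condCols_nonneg (hg' _ _) _ _ _)
    calc ∑ p ∈ W, spike (v p') (t j) * (spike (v p) (idState q) *
          condCols t (colView g π s) j x (Function.update y j v))
        = (∑ p ∈ W, spike (v p) (idState q)) * (spike (v p') (t j) *
          condCols t (colView g π s) j x (Function.update y j v)) := by
          rw [sum_mul]; exact sum_congr rfl fun p _ => by ring
      _ ≤ (#W * Fintype.card (BlockState q)) * (spike (v p') (t j) *
          condCols t (colView g π s) j x (Function.update y j v)) :=
          mul_le_mul_of_nonneg_right h1 h2
      _ = _ := by ring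
  · intro p hp
    exact (hpos p hp).1.2.2

end Views

/-! ### The inequality for one rectangle -/

section CoreInequality

open Equiv

variable {K q r : ℕ} {P : Type} [Fintype P] [DecidableEq P] [Nonempty P]

theorem exists_perm_inl_mem {F : Finset (Core q)} (hF : #F = 3) :
    ∃ ρ : Perm (Core q), ∀ c, ρ c ∈ F ↔ ∃ a : Fin 3, c = Sum.inl a := by
  classical
  have hcard : Fintype.card {c : Core q // ∃ a : Fin 3, c = Sum.inl a} =
      Fintype.card {c // c ∈ F} := by
    rw [Fintype.card_coe, hF]
    have e : (univ.filter fun c : Core q => ∃ a : Fin 3, c = Sum.inl a) =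
        univ.image (Sum.inl : Fin 3 → Core q) := by
      ext c; simp [eq_comm]
    rw [Fintype.card_subtype, e, card_image_of_injective _ Sum.inl_injective]
    simp
  let e := Fintype.equivOfCardEq hcard
  refine ⟨e.extendSubtype, fun c => ⟨fun h => ?_, fun h => e.extendSubtype_mem c h⟩⟩
  by_contra hc
  exact e.extendSubtype_not_mem c hc h

/-- A permutation of the core moving the special elements to `F`. -/
noncomputable def moveTo (F : Finset (Core q)) : Perm (Core q) :=
  open Classical in if hF : #F = 3 then (exists_perm_inl_mem hF).choose else 1

theorem moveTo_mem_iff {F : Finset (Core q)} (hF : #F = 3) (c : Core q) :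
    moveTo F c ∈ F ↔ ∃ a : Fin 3, c = Sum.inl a := by
  rw [moveTo, dif_pos hF]
  exact (exists_perm_inl_mem hF).choose_spec c

/-- A block has at least four elements, so a transposition fixes one of them, while the flip fixes
none. -/
theorem swap_ne_flipState (hq : 2 ≤ q) (a b : Block q) : swap a b ≠ (flipState q).1 := by
  intro h
  obtain ⟨d, hd⟩ : ∃ d : Block q, d ∉ ({a, b} : Finset (Block q)) := by
    by_contra! hcon
    have h1 : (univ : Finset (Block q)) ⊆ {a, b} := fun d _ => hcon d
    have h2 := (card_le_card h1).trans (card_le_two)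
    simp at h2
    omega
  simp only [mem_insert, mem_singleton, not_or] at hd
  have h1 := congrArg (fun σ : Perm (Block q) => σ d) h
  simp only [swap_apply_of_ne_of_ne hd.1 hd.2, flipState] at h1
  have h2 := congrArg Prod.snd h1
  simp at h2

/-- If two triples meet in one element, then the same transposition of the core exchanges two
special elements in one view and two elements of the block in the other view. -/
theorem exists_common_swap (hq : 2 ≤ q) {F F' : Finset (Core q)} (hF : #F = 3) (hF' : #F' = 3)
    (h : #(F ∩ F') = 1) : ∃ (s : Perm (Fin 3)) (τ : BlockState q), s.IsSwap ∧ τ ≠ flipState q ∧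
      ((moveTo F)⁻¹ * moveTo F') * Equiv.sumCongr 1 τ.1 * ((moveTo F)⁻¹ * moveTo F')⁻¹ =
        Equiv.sumCongr s 1 := by
  -- The transposition exchanges these two elements: both are special when `F` plays the special
  -- elements, both lie in the block when `F'` does.
  have hc : #(F \ F') = 2 := by
    have := card_sdiff_add_card_inter F F'
    omega
  obtain ⟨a, b, hab, hFF⟩ := card_eq_two.1 hc
  have ha : a ∈ F ∧ a ∉ F' := by rw [← mem_sdiff, hFF]; simp
  have hb : b ∈ F ∧ b ∉ F' := by rw [← mem_sdiff, hFF]; simp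
  have hin : ∀ c, c ∈ F → ∃ i : Fin 3, moveTo F (Sum.inl i) = c := by
    intro c hc
    obtain ⟨i, hi⟩ := (moveTo_mem_iff hF ((moveTo F)⁻¹ c)).1 (by simpa using hc)
    exact ⟨i, by rw [← hi]; simp⟩
  have hout : ∀ c, c ∉ F' → ∃ d : Block q, moveTo F' (Sum.inr d) = c := by
    intro c hc
    rcases hd : (moveTo F')⁻¹ c with i | d
    · exact absurd ((moveTo_mem_iff hF' ((moveTo F')⁻¹ c)).2 ⟨i, hd⟩) (by simpa using hc)
    · exact ⟨d, by rw [← hd]; simp⟩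
  obtain ⟨i, hi⟩ := hin a ha.1
  obtain ⟨i', hi'⟩ := hin b hb.1
  obtain ⟨d, hd⟩ := hout a ha.2
  obtain ⟨d', hd'⟩ := hout b hb.2
  refine ⟨swap i i', ⟨swap d d', swap_mul_self d d'⟩, ⟨i, i', ?_, rfl⟩, ?_, ?_⟩
  · rintro rfl; exact hab (hi.symm.trans hi')
  · intro h
    exact swap_ne_flipState hq d d' (congrArg Subtype.val h)
  · have e1 : (Equiv.sumCongr 1 (swap d d') : Perm (Core q)) = swap (Sum.inr d) (Sum.inr d') :=
      Perm.sumCongr_one_swap d d'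
    have e2 : (Equiv.sumCongr (swap i i') 1 : Perm (Core q)) = swap (Sum.inl i) (Sum.inl i') :=
      Perm.sumCongr_swap_one i i'
    change (moveTo F)⁻¹ * moveTo F' * Equiv.sumCongr 1 (swap d d') * _ = _
    rw [e1, e2, ← swap_apply_apply]
    simp only [Perm.mul_apply, hd, hd']
    rw [← hi, ← hi']
    simp

variable {f : Finset (Ground K P q r) → ℝ} {g : Perm (Ground K P q r) → ℝ}

/-- All blocks are paired internally. -/
def flipTarget (K q : ℕ) : Fin K → BlockState q := fun _ => flipState q

/-- The mass of `f ⊗ g` on the random pairs which are cut three times. -/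
noncomputable def massThree (f : Finset (Ground K P q r) → ℝ) (g : Perm (Ground K P q r) → ℝ) :
    ℝ :=
  𝔼 π, rectMass (flipTarget K q) (rowView f π) (colView g π 1)

open Classical in
/-- The mass of `f ⊗ g` on the random pairs which are cut once. -/
noncomputable def massOne (f : Finset (Ground K P q r) → ℝ) (g : Perm (Ground K P q r) → ℝ) :
    ℝ :=
  ∑ s : Perm (Fin 3) with s.IsSwap,
    𝔼 π, rectMass (flipTarget K q) (rowView f π) (colView g π s)

/-- The mass of `f ⊗ g` on the random pairs in which all elements of one core are cut. -/
noncomputable def massCore (f : Finset (Ground K P q r) → ℝ) (g : Perm (Ground K P q r) → ℝ) :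
    ℝ :=
  𝔼 j, 𝔼 π, rectMass (Function.update (flipTarget K q) j (idState q)) (rowView f π)
    (colView g π 1)

theorem rectMass_nonneg {S : Type*} [Fintype S] [DecidableEq S] [Nonempty S] {t : Fin K → S}
    {f : (Fin K → P) → ℝ} {g : (Fin K → P → S) → ℝ} (hf : ∀ x, 0 ≤ f x) (hg : ∀ y, 0 ≤ g y) :
    0 ≤ rectMass t f g :=
  expect_nonneg fun x _ => expect_nonneg fun y _ =>
    mul_nonneg (prod_nonneg fun _ _ => spike_nonneg _ _) (mul_nonneg (hf x) (hg y))

/-- The average over all permutations is unchanged by a change of view of the core. -/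
theorem expect_change_view {Y : Type*} [Fintype Y] (κ : (Fin K → P) → Perm (Ground K P q r))
    (Φ : Perm (Ground K P q r) → (Fin K → P) → Y → ℝ) :
    𝔼 π, 𝔼 x, 𝔼 y, Φ (π * κ x) x y = 𝔼 π, 𝔼 x, 𝔼 y, Φ π x y := by
  rw [expect_comm, expect_comm (s := univ) (t := univ) (f := fun π x => 𝔼 y, Φ π x y)]
  exact expect_congr rfl fun x _ => Fintype.expect_equiv (Equiv.mulRight (κ x)) _ _ fun π => rfl

-- `sum_le_of_good` applied to every core and averaged. The uniform permutation absorbs each change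
-- of view, so every triple contributes `massThree`; the factor from `f` and the fully fixed core
-- are the same in all views, and the pairs of triples meeting once are bounded by `massOne`.
open Classical in
theorem massThree_le_of_row (hq : 2 ≤ q) (hf : ∀ u, 0 ≤ f u) (hg : ∀ ι, 0 ≤ g ι) {m : ℕ}
    (hm : 0 < m) (j : Fin K) {T : Finset (Finset (Core q))} (hT : ∀ F ∈ T, #F = 3) :
    #T * massThree f g ≤
      #T * (𝔼 π, 𝔼 x, 𝔼 y, condRows (flipTarget K q) (rowView f π) (j + 1) x y *
        condCols (flipTarget K q) (colView g π 1) (j + 1) x y *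
          if TypicalAt (flipTarget K q) (rowView f π) (colView g π 1) m j x y then 0 else 1) +
      (2 * Fintype.card (Core q) + #T / (Fintype.card (Core q) : ℝ) ^ 2) *
        (𝔼 π, rectMass (Function.update (flipTarget K q) j (idState q)) (rowView f π)
          (colView g π 1)) +
      2 * #T * (Fintype.card (Core q) : ℝ) ^ 2 *
        (#T ^ 2 * (4 * Fintype.card (BlockState q) * massOne f g)) := by
  have hf' : ∀ π x, 0 ≤ rowView f π x := fun π x => hf _
  have hg' : ∀ π s y, 0 ≤ colView g π s y := fun π s y => hg _
  set t := flipTarget K q with ht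
  -- the pointwise inequality, for a fixed core
  set a : Perm (Ground K P q r) → (Fin K → P) → (Fin K → P → BlockState q) → ℝ :=
    fun π x y => condRows t (rowView f π) (j + 1) x y with ha
  set b : Perm (Ground K P q r) → (Fin K → P) → (Fin K → P → BlockState q) → ℝ :=
    fun π x y => condCols t (colView g π 1) (j + 1) x y with hb
  set c : Perm (Ground K P q r) → (Fin K → P) → (Fin K → P → BlockState q) → ℝ :=
    fun π x y => condCols (Function.update t j (idState q)) (colView g π 1) (j + 1) x y with hc
  set typ : Perm (Ground K P q r) → (Fin K → P) → (Fin K → P → BlockState q) → Prop :=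
    fun π x y => TypicalAt t (rowView f π) (colView g π 1) m j x y with htyp
  set vw : Finset (Core q) → (Fin K → P) → Perm (Ground K P q r) :=
    fun F x => coreLift j (x j) (moveTo F) with hvw
  have ha0 : ∀ π x y, 0 ≤ a π x y := fun π x y => condRows_nonneg (hf' π) _ _ _
  have hb0 : ∀ π x y, 0 ≤ b π x y := fun π x y => condCols_nonneg (hg' π 1) _ _ _
  have hc0 : ∀ π x y, 0 ≤ c π x y := fun π x y => condCols_nonneg (hg' π 1) _ _ _
  have hav : ∀ F π x y, a (π * vw F x) x y = a π x y := fun F π x y =>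
    condRows_view_eq t π j (moveTo F) x y
  have hcv : ∀ F π x y, c (π * vw F x) x y = c π x y := by
    intro F π x y
    have h := rowMean_view_eq (g := g) t π j (x j) (s := 1) (τ := idState q) (κ := moveTo F)
      (by simp [idState]) x y
    rwa [rowMean_condCols, rowMean_condCols, Function.update_eq_self] at h
  have hgood : ∀ π x y, typ π x y → b π x y / 2 ≤ c π x y := by
    intro π x y h
    have h1 := h.1 (idState q)
    rwa [rowMean_condCols, rowMean_condCols, Function.update_eq_self, Function.update_eq_self]
      at h1
  have hpoint : ∀ π x y, ∑ F ∈ T, a π x y * b (π * vw F x) x y ≤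
      (∑ F ∈ T, a π x y * (b (π * vw F x) x y * if typ (π * vw F x) x y then 0 else 1)) +
      (2 * Fintype.card (Core q) + #T / (Fintype.card (Core q) : ℝ) ^ 2) *
        (a π x y * c π x y) +
      2 * #T * (Fintype.card (Core q) : ℝ) ^ 2 * ∑ F ∈ T, ∑ F' ∈ T, a π x y *
        if #(F ∩ F') = 1 then (if typ (π * vw F x) x y then 1 else 0) *
          ((if typ (π * vw F' x) x y then 1 else 0) * b (π * vw F' x) x y) else 0 := by
    intro π x y
    have h1 := sum_le_of_good T hT (b := fun F => b (π * vw F x) x y) (c := c π x y)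
      (good := fun F => typ (π * vw F x) x y) (fun F => hb0 _ _ _) (hc0 _ _ _)
      (fun F hF => by rw [← hcv F]; exact hgood _ _ _ hF)
    have h2 := mul_le_mul_of_nonneg_left h1 (ha0 π x y)
    simp only [← mul_sum]
    refine h2.trans (le_of_eq ?_)
    ring
  have hexp := expect_le_expect fun π (_ : π ∈ univ) => expect_le_expect fun x (_ : x ∈ univ) =>
    expect_le_expect fun y (_ : y ∈ univ) => hpoint π x y
  simp only [expect_add_distrib, ← mul_expect, expect_sum_comm] at hexp
  have e1 : ∀ F, 𝔼 π, 𝔼 x, 𝔼 y, a π x y * b (π * vw F x) x y = massThree f g := by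
    intro F
    have h := expect_change_view (vw F) (fun π x y => a π x y * b π x y)
    simp only [hav] at h
    rw [h, massThree]
    exact expect_congr rfl fun π _ => expect_condRows_mul_condCols (j + 1 : ℕ) j.2
  have e2 : ∀ F, 𝔼 π, 𝔼 x, 𝔼 y, a π x y * (b (π * vw F x) x y *
      if typ (π * vw F x) x y then 0 else 1) =
      𝔼 π, 𝔼 x, 𝔼 y, a π x y * b π x y * if typ π x y then 0 else 1 := by
    intro F
    have h := expect_change_view (vw F) (fun π x y => a π x y * (b π x y *
      if typ π x y then 0 else 1))
    simp only [hav] at h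
    rw [h]
    simp only [mul_assoc]
  have e3 : 𝔼 π, 𝔼 x, 𝔼 y, a π x y * c π x y = 𝔼 π, rectMass (Function.update t j (idState q))
      (rowView f π) (colView g π 1) := by
    refine expect_congr rfl fun π _ => ?_
    rw [← expect_condRows_mul_condCols (j + 1 : ℕ) j.2]
    refine expect_congr rfl fun x _ => expect_congr rfl fun y _ => ?_
    simp only [ha, hc]
    -- Only the target of row `j` is altered, and at stage `j + 1` the mean of `f` no longer
    -- involves that row.
    rw [condRows_congr_target fun i hi => ?_]
    rw [Function.update_of_ne]
    rintro rfl; omega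
  have hone0 : 0 ≤ massOne f g := sum_nonneg fun s _ => expect_nonneg fun π _ =>
    rectMass_nonneg (hf' π) (hg' π s)
  have e4 : ∀ F ∈ T, ∀ F' ∈ T, 𝔼 π, 𝔼 x, 𝔼 y, a π x y *
      (if #(F ∩ F') = 1 then (if typ (π * vw F x) x y then 1 else 0) *
          ((if typ (π * vw F' x) x y then 1 else 0) * b (π * vw F' x) x y) else 0) ≤
      4 * Fintype.card (BlockState q) * massOne f g := by
    intro F hF F' hF'
    by_cases hFF : #(F ∩ F') = 1
    · simp only [hFF, if_true]
      obtain ⟨s, τ, hs, hτ, hκ⟩ := exists_common_swap hq (hT F hF) (hT F' hF') hFF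
      set κ := (moveTo F)⁻¹ * moveTo F' with hκdef
      have hmul : ∀ π x, π * vw F x * coreLift j (x j) κ = π * vw F' x := by
        intro π x
        rw [mul_assoc, hvw]
        simp only
        rw [← coreLift_mul, hκdef, mul_inv_cancel_left]
      have h := expect_change_view (vw F) (fun π x y => a π x y *
        ((if typ π x y then 1 else 0) *
          ((if typ (π * coreLift j (x j) κ) x y then 1 else 0) *
            b (π * coreLift j (x j) κ) x y)))
      simp only [hav, hmul] at h
      rw [h]
      calc 𝔼 π, 𝔼 x, 𝔼 y, a π x y * ((if typ π x y then 1 else 0) *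
            ((if typ (π * coreLift j (x j) κ) x y then 1 else 0) *
              b (π * coreLift j (x j) κ) x y))
          ≤ 𝔼 π, 4 * Fintype.card (BlockState q) * rectMass t (rowView f π) (colView g π s) :=
            expect_le_expect fun π _ => expect_typical_pair_le hf hg hm π j hκ hτ
              (flipState_ne_idState hq).symm
        _ = 4 * Fintype.card (BlockState q) *
            𝔼 π, rectMass t (rowView f π) (colView g π s) := by rw [mul_expect]
        _ ≤ _ := by
            refine mul_le_mul_of_nonneg_left ?_ (by positivity)
            exact single_le_sum (f := fun s => 𝔼 π, rectMass t (rowView f π) (colView g π s))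
              (fun s _ => expect_nonneg fun π _ => rectMass_nonneg (hf' π) (hg' π s))
              (by simpa using hs)
    · simp only [hFF, if_false, mul_zero, expect_const_zero]
      positivity
  have e5 := sum_le_sum fun F hF => sum_le_sum fun F' hF' => e4 F hF F' hF'
  simp only [e1, e2, e3, sum_const, nsmul_eq_mul] at hexp
  simp only [sum_const, nsmul_eq_mul] at e5
  refine hexp.trans (add_le_add le_rfl (mul_le_mul_of_nonneg_left (e5.trans (le_of_eq ?_))
    (by positivity)))
  ring

/-- The main inequality: rectangles with mass on the pairs which are cut three times have mass on
the pairs which are cut once, or a lot of mass on the pairs in which a whole core is cut. -/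
theorem massThree_le (hq : 2 ≤ q) (hK : 0 < K) (hf0 : ∀ u, 0 ≤ f u) (hf1 : ∀ u, f u ≤ 1)
    (hg0 : ∀ ι, 0 ≤ g ι) (hg1 : ∀ ι, g ι ≤ 1) {Λ : ℝ} (hΛ : 1 < Λ) {m : ℕ} (hm0 : 0 < m)
    (hm : 96 * (Fintype.card (BlockState q) : ℝ) ^ 3 * Λ ≤ m)
    (hsmall : 3 * m * Fintype.card (BlockState q) * Λ / Fintype.card P ≤ 1 / 8)
    (hlog : 80 * (Fintype.card (BlockState q) : ℝ) ≤ Real.log Λ)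
    {k N : ℝ} (hk : k = 3 + 2 * q) (hN : N = (3 + 2 * q).choose 3) :
    1 / 2 * massThree f g ≤ (2 * k / N + 1 / k ^ 2) * massCore f g +
      8 * k ^ 2 * N ^ 2 * Fintype.card (BlockState q) * massOne f g +
      Real.exp (-(K * Real.log Λ / 40)) := by
  classical
  have : Nonempty (Fin K) := ⟨⟨0, hK⟩⟩
  set T : Finset (Finset (Core q)) := powersetCard 3 univ with hT
  have hcore : Fintype.card (Core q) = 3 + 2 * q := by
    simp [Fintype.card_sum]; ring
  have hkc : (Fintype.card (Core q) : ℝ) = k := by rw [hcore, hk]; push_cast; ring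
  have hNc : (#T : ℝ) = N := by
    rw [hT, card_powersetCard, card_univ, hcore, hN]
  have hN0 : 0 < N := by
    rw [hN]; exact_mod_cast Nat.choose_pos (by omega)
  have h1 := expect_le_expect fun j (_ : j ∈ (univ : Finset (Fin K))) =>
    massThree_le_of_row (T := T) hq hf0 hg0 hm0 j (fun F hF => (mem_powersetCard.1 hF).2)
  rw [Fintype.expect_const] at h1
  simp only [expect_add_distrib, ← mul_expect, Fintype.expect_const] at h1
  rw [hkc, hNc, expect_comm] at h1
  have h2 := expect_le_expect fun π (_ : π ∈ (univ : Finset (Perm (Ground K P q r)))) =>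
    expect_not_typicalAt_le_half (t := flipTarget K q) (f := rowView f π) (g := colView g π 1)
      hK (fun x => hf0 _) (fun x => hf1 _) (fun y => hg0 _) (fun y => hg1 _) hΛ hm0 hm hsmall hlog
  rw [expect_add_distrib, ← mul_expect, Fintype.expect_const] at h2
  change _ ≤ 1 / 2 * massThree f g + _ at h2
  have h3 := h1.trans (add_le_add (add_le_add (mul_le_mul_of_nonneg_left h2 hN0.le) le_rfl) le_rfl)
  change N * massThree f g ≤ N * (1 / 2 * massThree f g + Real.exp (-(K * Real.log Λ / 40))) +
    (2 * k + N / k ^ 2) * massCore f g + _ at h3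
  have hk0 : 0 < k := by rw [hk]; positivity
  have h4 : N * (1 / 2 * massThree f g) ≤ N * ((2 * k / N + 1 / k ^ 2) * massCore f g +
      8 * k ^ 2 * N ^ 2 * Fintype.card (BlockState q) * massOne f g +
      Real.exp (-(K * Real.log Λ / 40))) := by
    have e : N * (2 * k / N + 1 / k ^ 2) = 2 * k + N / k ^ 2 := by field_simp
    have e' : N * ((2 * k / N + 1 / k ^ 2) * massCore f g) =
      (2 * k + N / k ^ 2) * massCore f g := by rw [← e]; ring
    rw [mul_add, mul_add, e']
    linarith
  exact le_of_mul_le_mul_left h4 hN0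

end CoreInequality

/-! ### Counting cut elements -/

section Counts

open Equiv

variable {I : Type*} [Fintype I] [DecidableEq I]

/-- The number of elements of `u` which the involution `ι` does not pair inside `u`. -/
def cutCount (ι : Perm I) (u : Finset I) : ℕ := #(u.filter fun i => ι i = i ∨ ι i ∉ u)

theorem cutCount_conj (ι π : Perm I) (u : Finset I) :
    cutCount (π * ι * π⁻¹) (u.map π.toEmbedding) = cutCount ι u := by
  unfold cutCount
  rw [filter_map, card_map]
  congr 1
  refine filter_congr fun i _ => ?_
  simp [Perm.mul_apply]

variable {K q r : ℕ} {P : Type} [Fintype P] [DecidableEq P]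

/-- The elements of `rowSet x`, by name. -/
def rowEmbedding (x : Fin K → P) : Fin 3 ⊕ Fin K × Block q ↪ Ground K P q r where
  toFun := Sum.elim Sum.inl fun w => Sum.inr (Sum.inl (w.1, x w.1, w.2))
  inj' := by
    rintro (a | ⟨i, a⟩) (b | ⟨j, b⟩) h <;> simp_all

@[simp] theorem rowEmbedding_inl (x : Fin K → P) (a : Fin 3) :
    (rowEmbedding x (Sum.inl a) : Ground K P q r) = Sum.inl a := rfl

@[simp] theorem rowEmbedding_inr (x : Fin K → P) (i : Fin K) (b : Block q) :
    (rowEmbedding x (Sum.inr (i, b)) : Ground K P q r) = Sum.inr (Sum.inl (i, x i, b)) := rfl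

theorem rowSet_eq_map (x : Fin K → P) :
    (rowSet x : Finset (Ground K P q r)) = univ.map (rowEmbedding x) := by
  ext z
  rw [mem_map]
  rcases z with a | ⟨i, p, b⟩ | c
  · exact iff_of_true (inl_mem_rowSet x a) ⟨Sum.inl a, mem_univ _, rfl⟩
  · rw [block_mem_rowSet]
    constructor
    · intro h
      obtain rfl : p = x i := h
      exact ⟨Sum.inr (i, b), mem_univ _, rfl⟩
    · rintro ⟨a | ⟨i', b'⟩, -, h⟩
      · simp at h
      · simp only [rowEmbedding_inr, Sum.inr.injEq, Sum.inl.injEq, Prod.mk.injEq] at h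
        obtain ⟨rfl, h, -⟩ := h
        exact h.symm
  · refine iff_of_false (spare_notMem_rowSet x c) ?_
    rintro ⟨a | ⟨i, b⟩, -, h⟩ <;> simp at h

theorem card_rowSet (x : Fin K → P) :
    #(rowSet x : Finset (Ground K P q r)) = 3 + 2 * q * K := by
  rw [rowSet_eq_map, card_map, card_univ]
  simp only [Fintype.card_sum, Fintype.card_prod, Fintype.card_fin, Fintype.card_bool]
  ring

/-- A pairing preserves the row set, so an element is cut exactly when it is fixed. -/
theorem cutCount_pairing (s : Perm (Fin 3)) (x : Fin K → P) (y : Fin K → P → BlockState q) :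
    cutCount (pairing s y : Perm (Ground K P q r)) (rowSet x) =
      #(univ.filter fun a => s a = a) +
        ∑ i, #(univ.filter fun b => (y i (x i)).1 b = b) := by
  unfold cutCount
  have h1 : ((rowSet x : Finset (Ground K P q r)).filter fun z => pairing s y z = z ∨
      pairing s y z ∉ rowSet x) = (rowSet x).filter fun z => pairing s y z = z := by
    refine filter_congr fun z hz => or_iff_left fun h => h ?_
    rcases z with a | ⟨i, p, b⟩ | c
    · simp
    · simpa using hz
    · simp at hz
  rw [h1, rowSet_eq_map, filter_map, card_map, card_filter, Fintype.sum_sum_type,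
    Fintype.sum_prod_type, card_filter]
  simp only [card_filter]
  congr 1
  · simp
  · simp

theorem card_fixed_idState (q : ℕ) : #(univ.filter fun b => (idState q).1 b = b) = 2 * q := by
  simp [idState, Fintype.card_prod, mul_comm]

theorem card_fixed_flipState (q : ℕ) : #(univ.filter fun b => (flipState q).1 b = b) = 0 := by
  rw [card_eq_zero, filter_eq_empty_iff]
  rintro ⟨a, b⟩ - h
  simpa [flipState] using congrArg Prod.snd h

theorem cutCount_pairing_flip {s : Perm (Fin 3)} {x : Fin K → P} {y : Fin K → P → BlockState q}
    (h : ∀ i, y i (x i) = flipTarget K q i) :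
    cutCount (pairing s y : Perm (Ground K P q r)) (rowSet x) =
      #(univ.filter fun a => s a = a) := by
  rw [cutCount_pairing]
  simp [h, flipTarget, card_fixed_flipState]

theorem cutCount_pairing_core {x : Fin K → P} {y : Fin K → P → BlockState q} {j : Fin K}
    (h : ∀ i, y i (x i) = Function.update (flipTarget K q) j (idState q) i) :
    cutCount (pairing 1 y : Perm (Ground K P q r)) (rowSet x) = 3 + 2 * q := by
  rw [cutCount_pairing, sum_eq_single j]
  · rw [h, Function.update_self, card_fixed_idState]
    simp
  · intro i _ hi
    rw [h, Function.update_of_ne hi, flipTarget, card_fixed_flipState]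
  · simp

theorem pairing_mul_self {s : Perm (Fin 3)} (hs : s * s = 1) (y : Fin K → P → BlockState q) :
    (pairing s y : Perm (Ground K P q r)) * pairing s y = 1 := by
  have hs' : ∀ a, s (s a) = a := fun a => by rw [← Perm.mul_apply, hs, Perm.one_apply]
  ext1 z
  rw [Perm.mul_apply, Perm.one_apply]
  rcases z with a | ⟨i, p, b⟩ | c <;> simp [hs', BlockState.apply_apply]

end Counts

/-! ### From involutions to perfect matchings -/

section Matchings

open Equiv

variable {V : Type*}

/-- The matching in which `a` is matched with `μ a`. -/
def involutionMatching (μ : V → V) (hμ : ∀ a, μ (μ a) = a) (hne : ∀ a, μ a ≠ a) :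
    (⊤ : SimpleGraph V).Subgraph where
  verts := Set.univ
  Adj a b := μ a = b
  adj_sub := by
    rintro a b rfl
    exact (hne a).symm
  edge_vert _ := Set.mem_univ _
  symm := ⟨by
    rintro a b rfl
    exact hμ a⟩

theorem involutionMatching_isPerfectMatching {μ : V → V} (hμ : ∀ a, μ (μ a) = a)
    (hne : ∀ a, μ a ≠ a) : (involutionMatching μ hμ hne).IsPerfectMatching :=
  SimpleGraph.Subgraph.isPerfectMatching_iff.2 fun a =>
    ⟨μ a, rfl, fun b (h : μ a = b) => h.symm⟩

/-- Each cut edge of the matching is counted by its unique end in `u`. -/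
theorem ncard_cutEdges_inter [DecidableEq V] {μ : V → V} (hμ : ∀ a, μ (μ a) = a)
    (hne : ∀ a, μ a ≠ a) (u : Finset V) :
    (cutEdges u ∩ (involutionMatching μ hμ hne).edgeSet).ncard =
      #(u.filter fun a => μ a ∉ u) := by
  have h : cutEdges u ∩ (involutionMatching μ hμ hne).edgeSet =
      (fun a => s(a, μ a)) '' (u.filter fun a => μ a ∉ u : Finset V) := by
    ext e
    simp only [Set.mem_inter_iff, Set.mem_image, coe_filter, Set.mem_ofPred_eq]
    constructor
    · rintro ⟨⟨a, ha, b, hb, rfl⟩, hab⟩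
      rw [SimpleGraph.Subgraph.mem_edgeSet] at hab
      have hab : μ a = b := hab
      subst hab
      exact ⟨a, ⟨ha, hb⟩, rfl⟩
    · rintro ⟨a, ⟨ha, hb⟩, rfl⟩
      refine ⟨⟨a, ha, _, hb, rfl⟩, ?_⟩
      rw [SimpleGraph.Subgraph.mem_edgeSet]
      rfl
  rw [h, Set.InjOn.ncard_image, Set.ncard_coe_finset]
  intro a ha b hb hab
  simp only [coe_filter, Set.mem_ofPred_eq] at ha hb
  rcases Sym2.eq_iff.1 hab with ⟨h, -⟩ | ⟨h, -⟩
  · exact h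
  · exact absurd (h ▸ ha.1) hb.2

variable {I : Type*} [Fintype I] [DecidableEq I] {n : ℕ}

/-- The fixed-point-free involution of `I × Bool` attached to an involution `ι` of `I`. -/
def mate (ι : Perm I) (w : I × Bool) : I × Bool := if ι w.1 = w.1 then (w.1, !w.2) else (ι w.1, w.2)

theorem mate_mate {ι : Perm I} (hι : ι * ι = 1) (w : I × Bool) : mate ι (mate ι w) = w := by
  have h : ∀ a, ι (ι a) = a := fun a => by rw [← Perm.mul_apply, hι, Perm.one_apply]
  obtain ⟨i, b⟩ := w
  by_cases hi : ι i = i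
  · simp [mate, hi]
  · simp [mate, hi, h, Ne.symm hi]

theorem mate_ne (ι : Perm I) (w : I × Bool) : mate ι w ≠ w := by
  unfold mate
  split_ifs with h
  · intro h'
    simpa using congrArg Prod.snd h'
  · intro h'
    exact h (congrArg Prod.fst h')

/-- The perfect matching of `Fin n` attached to an involution `ι` of `I`. -/
def permMatching (e : I × Bool ≃ Fin n) (ι : Perm I) (hι : ι * ι = 1) :
    CompleteGraphPerfectMatching n :=
  ⟨involutionMatching (fun a => e (mate ι (e.symm a))) (fun a => by simp [mate_mate hι])
    fun a h => mate_ne ι (e.symm a) (by rw [Equiv.eq_symm_apply, h]),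
    involutionMatching_isPerfectMatching _ _⟩

/-- A set of elements of `I`, as a set of vertices. -/
def liftSet (e : I × Bool ≃ Fin n) (u : Finset I) : Finset (Fin n) :=
  u.map ((Function.Embedding.sectL I false).trans e.toEmbedding)

@[simp] theorem card_liftSet (e : I × Bool ≃ Fin n) (u : Finset I) : #(liftSet e u) = #u :=
  card_map _

theorem mem_liftSet (e : I × Bool ≃ Fin n) (u : Finset I) (w : I × Bool) :
    e w ∈ liftSet e u ↔ w.1 ∈ u ∧ w.2 = false := by
  obtain ⟨i, b⟩ := w
  simp only [liftSet, mem_map, Function.Embedding.trans_apply, Function.Embedding.sectL_apply,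
    Equiv.coe_toEmbedding, EmbeddingLike.apply_eq_iff_eq, Prod.mk.injEq]
  constructor
  · rintro ⟨a, ha, rfl, rfl⟩; exact ⟨ha, rfl⟩
  · rintro ⟨h, rfl⟩; exact ⟨i, h, rfl, rfl⟩

theorem ncard_cutEdges_permMatching (e : I × Bool ≃ Fin n) {ι : Perm I} (hι : ι * ι = 1)
    (u : Finset I) : (cutEdges (liftSet e u) ∩ (permMatching e ι hι).1.edgeSet).ncard =
      cutCount ι u := by
  rw [permMatching, ncard_cutEdges_inter, cutCount, liftSet, filter_map, card_map]
  congr 1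
  refine filter_congr fun i _ => ?_
  have h : ∀ w, e w ∈ u.map ((Function.Embedding.sectL I false).trans e.toEmbedding) ↔
      w.1 ∈ u ∧ w.2 = false := mem_liftSet e u
  simp only [Function.comp, Function.Embedding.trans_apply, Function.Embedding.sectL_apply,
    Equiv.coe_toEmbedding, Equiv.symm_apply_apply, h, mate]
  split_ifs with hi <;> simp [hi]

theorem matchingSlack_apply_liftSet {β ε : ℝ} (e : I × Bool ≃ Fin n) {ι : Perm I} (hι : ι * ι = 1)
    {u : Finset I} (hu : Odd #(liftSet e u) ∧ (#(liftSet e u) : ℝ) ≤ 1 + β / ε) :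
    matchingSlack n β ε ⟨liftSet e u, hu⟩ (permMatching e ι hι) =
      ((cutCount ι u : ℝ) + β - 1) / 2 := by
  rw [matchingSlack, Matrix.of_apply, ncard_cutEdges_permMatching]

end Matchings

/-! ### Normalizing the rectangles and summing them -/

section Scaling

open Equiv

variable {K q r : ℕ} {P : Type} [Fintype P] [DecidableEq P] [Nonempty P]
  {f : Finset (Ground K P q r) → ℝ} {g : Perm (Ground K P q r) → ℝ}

theorem rectMass_smul {S : Type*} [Fintype S] [DecidableEq S] [Nonempty S] (t : Fin K → S)
    (f : (Fin K → P) → ℝ) (g : (Fin K → P → S) → ℝ) (a b : ℝ) :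
    rectMass t (fun x => a * f x) (fun y => b * g y) = a * b * rectMass t f g := by
  simp only [rectMass, mul_expect]
  refine expect_congr rfl fun x _ => expect_congr rfl fun y _ => ?_
  ring

theorem massThree_smul (a b : ℝ) :
    massThree (fun u => a * f u) (fun ι => b * g ι) = a * b * massThree f g := by
  rw [massThree, massThree, mul_expect]
  exact expect_congr rfl fun π _ => rectMass_smul _ _ _ a b

theorem massOne_smul (a b : ℝ) :
    massOne (fun u => a * f u) (fun ι => b * g ι) = a * b * massOne f g := by
  rw [massOne, massOne, mul_sum]
  refine sum_congr rfl fun s _ => ?_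
  rw [mul_expect]
  exact expect_congr rfl fun π _ => rectMass_smul _ _ _ a b

theorem massCore_smul (a b : ℝ) :
    massCore (fun u => a * f u) (fun ι => b * g ι) = a * b * massCore f g := by
  rw [massCore, massCore, mul_expect]
  refine expect_congr rfl fun j _ => ?_
  rw [mul_expect]
  exact expect_congr rfl fun π _ => rectMass_smul _ _ _ a b

/-- A rank-one nonnegative function is a multiple of a product of functions with values in
`[0, 1]`. -/
theorem exists_scaling {A B : Type*} [Fintype A] [Fintype B] [Nonempty A] [Nonempty B]
    {f : A → ℝ} {g : B → ℝ} (hf : ∀ a, 0 ≤ f a) (hg : ∀ b, 0 ≤ g b) {M : ℝ}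
    (hM : ∀ a b, f a * g b ≤ M) :
    ∃ (a b : ℝ) (f' : A → ℝ) (g' : B → ℝ), 0 ≤ a * b ∧ a * b ≤ M ∧ (f = fun i => a * f' i) ∧
      (g = fun i => b * g' i) ∧ (∀ i, 0 ≤ f' i) ∧ (∀ i, f' i ≤ 1) ∧ (∀ i, 0 ≤ g' i) ∧
      ∀ i, g' i ≤ 1 := by
  obtain ⟨i, hi⟩ := Finite.exists_max f
  obtain ⟨j, hj⟩ := Finite.exists_max g
  refine ⟨f i, g j, fun a => f a / f i, fun b => g b / g j, mul_nonneg (hf i) (hg j), hM i j,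
    ?_, ?_, fun a => div_nonneg (hf a) (hf i), fun a => div_le_one_of_le₀ (hi a) (hf i),
    fun b => div_nonneg (hg b) (hg j), fun b => div_le_one_of_le₀ (hj b) (hg j)⟩
  · funext a
    rcases (hf i).eq_or_lt with h | h
    · have h1 := hi a
      have h2 := hf a
      rw [← h] at h1 ⊢
      simpa using le_antisymm h1 h2
    · field_simp
  · funext b
    rcases (hg j).eq_or_lt with h | h
    · have h1 := hj b
      have h2 := hg b
      rw [← h] at h1 ⊢
      simpa using le_antisymm h1 h2
    · field_simp

/-- The three masses are homogeneous and only the error term is not, so normalizing the factors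
multiplies that term by at most `M`. -/
theorem massThree_le_of_mul_le (hq : 2 ≤ q) (hK : 0 < K) (hf : ∀ u, 0 ≤ f u) (hg : ∀ ι, 0 ≤ g ι)
    {M : ℝ} (hM : ∀ u ι, f u * g ι ≤ M) {Λ : ℝ} (hΛ : 1 < Λ) {m : ℕ} (hm0 : 0 < m)
    (hm : 96 * (Fintype.card (BlockState q) : ℝ) ^ 3 * Λ ≤ m)
    (hsmall : 3 * m * Fintype.card (BlockState q) * Λ / Fintype.card P ≤ 1 / 8)
    (hlog : 80 * (Fintype.card (BlockState q) : ℝ) ≤ Real.log Λ)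
    {k N : ℝ} (hk : k = 3 + 2 * q) (hN : N = (3 + 2 * q).choose 3) :
    1 / 2 * massThree f g ≤ (2 * k / N + 1 / k ^ 2) * massCore f g +
      8 * k ^ 2 * N ^ 2 * Fintype.card (BlockState q) * massOne f g +
      M * Real.exp (-(K * Real.log Λ / 40)) := by
  obtain ⟨a, b, f', g', hab, habM, rfl, rfl, hf0, hf1, hg0, hg1⟩ := exists_scaling hf hg hM
  rw [massThree_smul, massCore_smul, massOne_smul]
  have h := mul_le_mul_of_nonneg_left (massThree_le hq hK hf0 hf1 hg0 hg1 hΛ hm0 hm hsmall hlog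
    hk hN) hab
  have h' := mul_le_mul_of_nonneg_right habM (Real.exp_pos (-(K * Real.log Λ / 40))).le
  linarith

theorem expect_prod_apply {ι A : Type*} [Fintype ι] [DecidableEq ι] [Fintype A]
    (F : ι → A → ℝ) : 𝔼 y : ι → A, ∏ i, F i (y i) = ∏ i, 𝔼 a, F i a := by
  simp only [Fintype.expect_eq_sum_div_card, prod_div_distrib]
  rw [prod_univ_sum, Fintype.piFinset_univ]
  simp

/-- For fixed `x` the product of spikes is a probability density in `y`, so a sum of rectangles that
is constant on its support has that constant as total mass. -/
theorem sum_rectMass {S : Type*} [Fintype S] [DecidableEq S] [Nonempty S] (t : Fin K → S)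
    {R : Type*} [Fintype R] (f : R → (Fin K → P) → ℝ) (g : R → (Fin K → P → S) → ℝ) {c : ℝ}
    (h : ∀ x y, (∀ i, y i (x i) = t i) → ∑ l, f l x * g l y = c) :
    ∑ l, rectMass t (f l) (g l) = c := by
  simp only [rectMass]
  rw [← expect_sum_comm]
  have h1 : ∀ x : Fin K → P, ∑ l, 𝔼 y, (∏ i, spike (y i (x i)) (t i)) * (f l x * g l y) = c := by
    intro x
    rw [← expect_sum_comm]
    have h2 : ∀ y : Fin K → P → S, ∑ l, (∏ i, spike (y i (x i)) (t i)) * (f l x * g l y) =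
        (∏ i, spike (y i (x i)) (t i)) * c := by
      intro y
      rw [← mul_sum]
      by_cases hy : ∀ i, y i (x i) = t i
      · rw [h x y hy]
      · push Not at hy
        obtain ⟨i, hi⟩ := hy
        rw [prod_eq_zero (mem_univ i) (by simp [spike, hi]), zero_mul, zero_mul]
    simp only [h2]
    rw [← expect_mul, expect_prod_apply fun i (v : P → S) => spike (v (x i)) (t i)]
    simp [expect_spike_apply]
  simp only [h1, Fintype.expect_const]

end Scaling

/-! ### Averaging a nonnegative factorization -/

section Factorization

open Equiv

/-- An odd set that is not cut would be perfectly matched within itself. -/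
theorem one_le_ncard_cutEdges {n : ℕ} {u : Finset (Fin n)} (hu : Odd #u)
    (M : CompleteGraphPerfectMatching n) : 1 ≤ (cutEdges u ∩ M.1.edgeSet).ncard := by
  classical
  rw [Nat.one_le_iff_ne_zero]
  intro hemp
  rw [Set.ncard_eq_zero] at hemp
  have hmem : ∀ a ∈ u, ∀ b, M.1.Adj a b → b ∈ u := by
    intro a ha b hab
    by_contra hb
    have h : s(a, b) ∈ cutEdges u ∩ M.1.edgeSet := ⟨⟨a, ha, b, hb, rfl⟩, hab⟩
    rw [hemp] at h
    exact h
  have hmatch : (M.1.induce (u : Set (Fin n))).IsMatching := by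
    intro a ha
    have ha : a ∈ u := ha
    obtain ⟨b, hb, hb'⟩ := SimpleGraph.Subgraph.isPerfectMatching_iff.1 M.2 a
    exact ⟨b, ⟨ha, hmem a ha b hb, hb⟩, fun c hc => hb' c hc.2.2⟩
  have h := hmatch.even_card
  rw [← Set.ncard_eq_toFinset_card', SimpleGraph.Subgraph.induce_verts,
    Set.ncard_coe_finset] at h
  exact (Nat.not_even_iff_odd.2 hu) h

theorem matchingSlack_nonneg {n : ℕ} {β ε : ℝ} (hβ : 0 ≤ β) (u : OddCut n β ε)
    (M : CompleteGraphPerfectMatching n) : 0 ≤ matchingSlack n β ε u M := by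
  have h : (1 : ℝ) ≤ (cutEdges u.1 ∩ M.1.edgeSet).ncard := by
    exact_mod_cast one_le_ncard_cutEdges u.2.1 M
  rw [matchingSlack, Matrix.of_apply]
  linarith

variable {n : ℕ} {β ε : ℝ}

/-- Covers the case in which the binomial coefficient is one: a singleton yields the nonzero entry
`β / 2`. -/
theorem nonnegRank_matchingSlack_pos (hn : 0 < n) (heven : Even n) (hβ : 0 < β) (hε : 0 < ε) :
    0 < nonnegRank (matchingSlack n β ε) := by
  obtain ⟨h, hh⟩ := heven
  have e : Fin h × Bool ≃ Fin n := Fintype.equivOfCardEq (by simp; omega)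
  have hu : Odd #(liftSet e {⟨0, by omega⟩}) ∧
      (#(liftSet e {⟨0, by omega⟩}) : ℝ) ≤ 1 + β / ε := by
    rw [card_liftSet, card_singleton]
    refine ⟨odd_one, ?_⟩
    have : 0 < β / ε := by positivity
    push_cast
    linarith
  have h1 := matchingSlack_apply_liftSet e (ι := 1) (one_mul 1) hu
  obtain ⟨U, V, -, -, hUV⟩ := (nonnegRank_isLeast _ (matchingSlack_nonneg (n := n) (ε := ε)
    hβ.le)).1
  rw [Nat.pos_iff_ne_zero]
  intro h0
  have h2 : matchingSlack n β ε ⟨_, hu⟩ (permMatching e 1 (one_mul 1)) = 0 := by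
    rw [hUV, Matrix.mul_apply]
    have : IsEmpty (Fin (nonnegRank (matchingSlack n β ε))) := by rw [h0]; infer_instance
    exact Fintype.sum_empty _
  rw [h1] at h2
  have h3 : cutCount (1 : Perm (Fin h)) {⟨0, by omega⟩} = 1 := by simp [cutCount]
  rw [h3] at h2
  norm_num at h2
  linarith

/-- Averaging the entries of the slack matrix over the random pairs bounds the nonnegative rank
from below. -/
theorem slack_average_le {K q B r : ℕ} (hq : 2 ≤ q) (hK : 0 < K) (hB : 0 < B)
    (hn : n = 2 * (3 + 2 * q * K * B + r)) (hβ : 0 < β) (hβ1 : β ≤ 1)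
    (hsize : ((3 + 2 * q * K : ℕ) : ℝ) ≤ 1 + β / ε)
    {Λ : ℝ} (hΛ : 1 < Λ) {m : ℕ} (hm0 : 0 < m)
    (hm : 96 * (Fintype.card (BlockState q) : ℝ) ^ 3 * Λ ≤ m)
    (hsmall : 3 * m * Fintype.card (BlockState q) * Λ / B ≤ 1 / 8)
    (hlog : 80 * (Fintype.card (BlockState q) : ℝ) ≤ Real.log Λ)
    {k N : ℝ} (hk : k = 3 + 2 * q) (hN : N = (3 + 2 * q).choose 3) :
    (2 + β) / 4 ≤ (2 * k / N + 1 / k ^ 2) * ((k - 1 + β) / 2) +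
      8 * k ^ 2 * N ^ 2 * Fintype.card (BlockState q) * (3 * (β / 2)) +
      nonnegRank (matchingSlack n β ε) *
        ((3 + 2 * q * K : ℕ) * Real.exp (-(K * Real.log Λ / 40))) := by
  classical
  have : Nonempty (Fin B) := ⟨⟨0, hB⟩⟩
  have : Nonempty (Fin K) := ⟨⟨0, hK⟩⟩
  let I := Ground K (Fin B) q r
  have hcard : Fintype.card (I × Bool) = Fintype.card (Fin n) := by
    simp only [I, Fintype.card_prod, Fintype.card_sum, Fintype.card_fin, Fintype.card_bool, hn]
    ring
  let e : I × Bool ≃ Fin n := Fintype.equivOfCardEq hcard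
  have hodd : ∀ u : Finset I, #u = 3 + 2 * q * K →
      Odd #(liftSet e u) ∧ (#(liftSet e u) : ℝ) ≤ 1 + β / ε := by
    intro u hu
    rw [card_liftSet, hu]
    exact ⟨⟨1 + q * K, by ring⟩, hsize⟩
  have hleast := (nonnegRank_isLeast _ (matchingSlack_nonneg (n := n) (ε := ε) hβ.le)).1
  generalize nonnegRank (matchingSlack n β ε) = R at hleast ⊢
  obtain ⟨U, V, hU, hV, hUV⟩ := hleast
  -- Only sets of this size and involutions occur among the random pairs; the value zero elsewhere
  -- keeps the functions total and nonnegative.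
  let f : Fin R → Finset I → ℝ := fun l u =>
    if h : #u = 3 + 2 * q * K then U ⟨liftSet e u, hodd u h⟩ l else 0
  let g : Fin R → Perm I → ℝ := fun l ι =>
    if h : ι * ι = 1 then V l (permMatching e ι h) else 0
  have hf : ∀ l u, 0 ≤ f l u := by
    intro l u
    simp only [f]
    split_ifs
    · exact hU _ _
    · rfl
  have hg : ∀ l ι, 0 ≤ g l ι := by
    intro l ι
    simp only [g]
    split_ifs
    · exact hV _ _
    · rfl
  have hfg : ∀ u ι, #u = 3 + 2 * q * K → ι * ι = 1 →
      ∑ l, f l u * g l ι = ((cutCount ι u : ℝ) + β - 1) / 2 := by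
    intro u ι hu hι
    rw [← matchingSlack_apply_liftSet e hι (hodd u hu), hUV, Matrix.mul_apply]
    simp only [f, g, dif_pos hu, dif_pos hι]
  -- One summand is at most the whole entry, and the entry is at most the size of `u`.
  have hM : ∀ l u ι, f l u * g l ι ≤ (3 + 2 * q * K : ℕ) := by
    intro l u ι
    by_cases hu : #u = 3 + 2 * q * K
    · by_cases hι : ι * ι = 1
      · have h1 := single_le_sum (f := fun l => f l u * g l ι)
          (fun l _ => mul_nonneg (hf l u) (hg l ι)) (mem_univ l)
        rw [hfg u ι hu hι] at h1
        have h2 : (cutCount ι u : ℝ) ≤ (3 + 2 * q * K : ℕ) := by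
          rw [← hu]
          exact_mod_cast card_filter_le _ _
        have h3 : (0 : ℝ) ≤ (cutCount ι u : ℝ) := by positivity
        linarith
      · simp only [g, dif_neg hι, mul_zero]
        positivity
    · simp only [f, dif_neg hu, zero_mul]
      positivity
  have hview : ∀ (π : Perm I) (s : Perm (Fin 3)) (hs : s * s = 1) (x : Fin K → Fin B)
      (y : Fin K → Fin B → BlockState q), ∑ l, rowView (f l) π x * colView (g l) π s y =
        ((cutCount (pairing s y : Perm I) (rowSet x) : ℝ) + β - 1) / 2 := by
    intro π s hs x y
    rw [← cutCount_conj (pairing s y) π (rowSet x)]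
    refine hfg _ _ (by rw [card_map, card_rowSet]) ?_
    have h := pairing_mul_self (r := r) hs y
    calc π * pairing s y * π⁻¹ * (π * pairing s y * π⁻¹)
        = π * (pairing s y * pairing s y) * π⁻¹ := by group
      _ = 1 := by rw [h]; group
  have hthree : ∑ l, massThree (f l) (g l) = (2 + β) / 2 := by
    simp only [massThree]
    rw [← expect_sum_comm]
    have h : ∀ π : Perm I, ∑ l, rectMass (flipTarget K q) (rowView (f l) π) (colView (g l) π 1) =
        (2 + β) / 2 := by
      intro π
      refine sum_rectMass _ _ _ fun x y hxy => ?_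
      rw [hview π 1 (one_mul 1), cutCount_pairing_flip hxy]
      norm_num
      ring
    simp only [h, Fintype.expect_const]
  have hcore : ∑ l, massCore (f l) (g l) = (k - 1 + β) / 2 := by
    simp only [massCore]
    rw [← expect_sum_comm]
    have h : ∀ j : Fin K, ∑ l, 𝔼 π, rectMass (Function.update (flipTarget K q) j (idState q))
        (rowView (f l) π) (colView (g l) π 1) = (k - 1 + β) / 2 := by
      intro j
      rw [← expect_sum_comm]
      have h : ∀ π : Perm I, ∑ l, rectMass (Function.update (flipTarget K q) j (idState q))
          (rowView (f l) π) (colView (g l) π 1) = (k - 1 + β) / 2 := by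
        intro π
        refine sum_rectMass _ _ _ fun x y hxy => ?_
        rw [hview π 1 (one_mul 1), cutCount_pairing_core hxy, hk]
        push_cast
        ring
      simp only [h, Fintype.expect_const]
    simp only [h, Fintype.expect_const]
  have hone : ∑ l, massOne (f l) (g l) = 3 * (β / 2) := by
    simp only [massOne]
    rw [sum_comm]
    have h : ∀ s ∈ univ.filter (fun s : Perm (Fin 3) => s.IsSwap), ∑ l, 𝔼 π,
        rectMass (flipTarget K q) (rowView (f l) π) (colView (g l) π s) = β / 2 := by
      intro s hs
      obtain ⟨a, b, hab, rfl⟩ := (mem_filter.1 hs).2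
      rw [← expect_sum_comm]
      have h : ∀ π : Perm I, ∑ l, rectMass (flipTarget K q) (rowView (f l) π)
          (colView (g l) π (swap a b)) = β / 2 := by
        intro π
        refine sum_rectMass _ _ _ fun x y hxy => ?_
        rw [hview π _ (swap_mul_self a b), cutCount_pairing_flip hxy]
        have h3 : #(univ.filter fun c => swap a b c = c) = 1 := by
          clear hs
          revert a b
          decide
        rw [h3]
        push_cast
        ring
      simp only [h, Fintype.expect_const]
    rw [sum_congr rfl h, sum_const, nsmul_eq_mul]
    congr 1
    have h3 : #(univ.filter fun s : Perm (Fin 3) => ∃ a b, a ≠ b ∧ s = swap a b) = 3 := by decide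
    have h4 : univ.filter (fun s : Perm (Fin 3) => s.IsSwap) =
        univ.filter fun s : Perm (Fin 3) => ∃ a b, a ≠ b ∧ s = swap a b :=
      filter_congr fun s _ => Iff.rfl
    rw [h4, h3]
    norm_num
  have hsum := sum_le_sum fun l (_ : l ∈ (univ : Finset (Fin R))) =>
    massThree_le_of_mul_le (f := f l) (g := g l) hq hK (hf l) (hg l) (hM l) hΛ hm0 hm
      (by rw [Fintype.card_fin]; exact hsmall) hlog hk hN
  rw [sum_add_distrib, sum_add_distrib, ← mul_sum, ← mul_sum, ← mul_sum, hthree, hcore, hone,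
    sum_const, card_univ, Fintype.card_fin, nsmul_eq_mul] at hsum
  refine le_trans (le_of_eq ?_) hsum
  ring

end Factorization

/-! ### Numerical estimates -/

section Numerics

theorem choose_le_pow_mul_exp (n a : ℕ) {T : ℝ} (hT : 0 < T) :
    (n.choose a : ℝ) ≤ (n / T) ^ a * Real.exp T := by
  have h1 : (n.choose a : ℝ) ≤ (n : ℝ) ^ a / (a.factorial : ℝ) := Nat.choose_le_pow_div a n
  have h2 := Real.pow_div_factorial_le_exp T hT.le a
  refine h1.trans ?_
  calc (n : ℝ) ^ a / (a.factorial : ℝ) = (n / T) ^ a * (T ^ a / (a.factorial : ℝ)) := by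
        rw [div_pow]; field_simp
    _ ≤ _ := mul_le_mul_of_nonneg_left h2 (by positivity)

/-- Here `252 = 4 * 63`: this swallows the bound `63 * K` on the size of the sets and the constant
`1 / 4`. -/
theorem mul_le_exp_mul (K : ℝ) (hK : 1 ≤ K) : 252 * K ≤ Real.exp (16 * K) := by
  have h1 : 4 * K + 1 ≤ Real.exp (4 * K) := Real.add_one_le_exp _
  have h2 : Real.exp (16 * K) = Real.exp (4 * K) ^ 4 := by
    rw [← Real.exp_nat_mul]; congr 1; push_cast; ring
  rw [h2]
  calc 252 * K ≤ 5 ^ 3 * (4 * K + 1) := by linarith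
    _ ≤ (4 * K + 1) ^ 3 * (4 * K + 1) := by gcongr; linarith
    _ = (4 * K + 1) ^ 4 := by ring
    _ ≤ _ := by gcongr

/-- An exponential lower bound for the nonnegative rank of the slack matrix, for a ground set
containing a large enough array of blocks. -/
theorem exp_le_nonnegRank {S : ℝ} (hS : S = Fintype.card (BlockState 30)) {n K B r : ℕ} {β ε : ℝ}
    (hK : 0 < K) (hB : 0 < B) (hn : n = 2 * (3 + 2 * 30 * K * B + r)) (hβ : 0 < β)
    (hβ1 : β ≤ 1 / (12 * (8 * 63 ^ 2 * 39711 ^ 2 * S)))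
    (hsize : ((3 + 2 * 30 * K : ℕ) : ℝ) ≤ 1 + β / ε)
    (hlog : 4656 * S ^ 4 + 320 * S ≤ Real.log B) :
    Real.exp (K * (Real.log B / 160 - 16)) ≤ nonnegRank (matchingSlack n β ε) := by
  have hS1 : 1 ≤ S := by rw [hS]; exact_mod_cast Fintype.card_pos
  have hB' : (0 : ℝ) < B := by exact_mod_cast hB
  have hK' : (1 : ℝ) ≤ K := by exact_mod_cast hK
  have hβ2 : β ≤ 1 := by
    refine hβ1.trans ?_
    rw [div_le_one (by positivity)]
    nlinarith
  set ℓ := Real.log B with hℓ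
  have hBexp : (B : ℝ) = Real.exp ℓ := (Real.exp_log hB').symm
  have hS4 : (1 : ℝ) ≤ S ^ 4 := one_le_pow₀ hS1
  have hS3 : (1 : ℝ) ≤ S ^ 3 := one_le_pow₀ hS1
  have hℓ0 : 0 < ℓ := by linarith
  -- `Λ` is the fourth root of `B`. As `m` is of order `S³ Λ`, the condition `hsmall` needs `S⁴ Λ²`
  -- to be small against `B`, which leaves a spare factor of the square root of `B`.
  set Λ := Real.exp (ℓ / 4) with hΛ
  have hΛ1 : 1 < Λ := Real.one_lt_exp_iff.2 (by linarith)
  have hlogΛ : Real.log Λ = ℓ / 4 := Real.log_exp _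
  have hSΛ : 1 ≤ S ^ 3 * Λ := one_le_mul_of_one_le_of_one_le hS3 hΛ1.le
  set m := ⌈96 * S ^ 3 * Λ⌉₊ with hm
  have hm1 : 96 * S ^ 3 * Λ ≤ m := Nat.le_ceil _
  have hm2 : (m : ℝ) ≤ 97 * S ^ 3 * Λ := by
    have h := Nat.ceil_lt_add_one (show 0 ≤ 96 * S ^ 3 * Λ by positivity)
    linarith
  have hm0 : 0 < m := Nat.ceil_pos.2 (by positivity)
  have hsmall : 3 * m * S * Λ / B ≤ 1 / 8 := by
    have h1 : 2328 * S ^ 4 ≤ Real.exp (ℓ / 2) := by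
      have := Real.add_one_le_exp (ℓ / 2)
      linarith
    have h2 : Λ * Λ = Real.exp (ℓ / 2) := by rw [hΛ, ← Real.exp_add]; congr 1; ring
    have h3 : (B : ℝ) = Real.exp (ℓ / 2) * Real.exp (ℓ / 2) := by
      rw [hBexp, ← Real.exp_add]; congr 1; ring
    rw [div_le_iff₀ hB']
    calc 3 * m * S * Λ ≤ 3 * (97 * S ^ 3 * Λ) * S * Λ := by gcongr
      _ = 1 / 8 * ((2328 * S ^ 4) * (Λ * Λ)) := by ring
      _ ≤ 1 / 8 * (Real.exp (ℓ / 2) * Real.exp (ℓ / 2)) := by rw [h2]; gcongr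
      _ = _ := by rw [h3]
  have hN : ((39711 : ℕ) : ℝ) = ((3 + 2 * 30).choose 3 : ℕ) := by
    norm_num [Nat.choose]
  have hmain := slack_average_le (n := n) (β := β) (ε := ε) (q := 30) (r := r) (m := m) (Λ := Λ)
    (k := 63) (N := 39711) (by norm_num) hK hB hn hβ hβ2 hsize hΛ1 hm0 (by rw [← hS]; exact hm1)
    (by rw [← hS]; exact hsmall) (by rw [← hS, hlogΛ]; linarith) (by norm_num)
    (by rw [← hN]; norm_num)
  rw [← hS, hlogΛ] at hmain
  set R : ℝ := (nonnegRank (matchingSlack n β ε) : ℝ) with hR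
  have hR0 : 0 ≤ R := Nat.cast_nonneg _
  have h1 : 8 * 63 ^ 2 * 39711 ^ 2 * S * (3 * (β / 2)) ≤ 1 / 8 := by
    rw [le_div_iff₀ (by positivity)] at hβ1
    linarith
  have h2 : (2 * 63 / 39711 + 1 / 63 ^ 2) * ((63 - 1 + β) / 2) ≤ 1 / 8 := by
    linarith
  set E := Real.exp (-(K * (ℓ / 4) / 40)) with hE
  have hE0 : 0 < E := Real.exp_pos _
  -- The left side of `hmain` is at least `1 / 2`. The core term takes `1 / 8`, for which `q = 30`
  -- is large enough; the pairs cut once take `1 / 8` by the bound on `β`.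
  have h3 : 1 / 4 ≤ R * ((3 + 2 * 30 * K : ℕ) * E) := by linarith
  have h4 : ((3 + 2 * 30 * K : ℕ) : ℝ) ≤ 63 * K := by push_cast; linarith
  have h5 : 1 / 4 ≤ R * (63 * K * E) := by
    refine h3.trans ?_
    gcongr
  have h6 : 1 ≤ R * (Real.exp (16 * K) * E) := by
    have h := mul_le_exp_mul K hK'
    have h' : R * (252 * K * E) ≤ R * (Real.exp (16 * K) * E) := by gcongr
    linarith
  have h7 : Real.exp (16 * K) * E * Real.exp (K * (ℓ / 160 - 16)) = 1 := by
    rw [hE, ← Real.exp_add, ← Real.exp_add, ← Real.exp_zero]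
    congr 1
    ring
  calc Real.exp (K * (ℓ / 160 - 16)) = 1 * Real.exp (K * (ℓ / 160 - 16)) := (one_mul _).symm
    _ ≤ R * (Real.exp (16 * K) * E) * Real.exp (K * (ℓ / 160 - 16)) := by gcongr
    _ = R := by rw [mul_assoc, h7, mul_one]

/-- Since `n / K ≤ B²`, the exponent is at most `2 * a * log B + K`, where `2 * a ≤ K / 640`; this
is far below `K * log B / 160` once `log B ≥ 4000`. -/
theorem choose_le_exp {n K B a : ℕ} (hK : 0 < K) (hB : 4000 ≤ Real.log B) (hn : n ≤ 480 * (K * B))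
    (ha : 1280 * a ≤ K) : (n.choose a : ℝ) ≤ Real.exp (K * (Real.log B / 160 - 16)) := by
  have hK' : (0 : ℝ) < K := by exact_mod_cast hK
  have hB' : (0 : ℝ) < B := by
    rcases Nat.eq_zero_or_pos B with rfl | h
    · simp at hB
      linarith
    · exact_mod_cast h
  set ℓ := Real.log B with hℓ
  have hBexp : (B : ℝ) = Real.exp ℓ := (Real.exp_log hB').symm
  have hn' : (n : ℝ) ≤ 480 * (K * B) := by exact_mod_cast hn
  have ha' : 1280 * (a : ℝ) ≤ K := by exact_mod_cast ha
  have h480 : (480 : ℝ) ≤ B := by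
    rw [hBexp]
    have := Real.add_one_le_exp ℓ
    linarith
  have h1 : (n : ℝ) / K ≤ Real.exp (2 * ℓ) := by
    rw [div_le_iff₀ hK']
    calc (n : ℝ) ≤ 480 * (K * B) := hn'
      _ ≤ B * (K * B) := by gcongr
      _ = B * B * K := by ring
      _ = Real.exp (2 * ℓ) * K := by rw [hBexp, ← Real.exp_add]; ring_nf
  calc (n.choose a : ℝ) ≤ (n / K) ^ a * Real.exp K := choose_le_pow_mul_exp n a hK'
    _ ≤ Real.exp (2 * ℓ) ^ a * Real.exp K := by gcongr
    _ = Real.exp (2 * ℓ * a + K) := by rw [← Real.exp_nat_mul, ← Real.exp_add]; ring_nf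
    _ ≤ _ := by
      refine Real.exp_le_exp.2 ?_
      nlinarith [mul_le_mul_of_nonneg_left ha' (show 0 ≤ ℓ by linarith),
        mul_le_mul_of_nonneg_left hB hK'.le]

end Numerics

end MatchingSlack

/-! ### The choice of constants -/

open MatchingSlack in
theorem theorem3p3 :
    ∃ β₀ : ℝ, 0 < β₀ ∧ β₀ < 1 ∧
      ∀ β : ℝ, 0 < β → β ≤ β₀ →
        ∃ α : ℝ, 0 < α ∧ α < 1 ∧
          ∃ c' : ℝ, 0 < c' ∧
            ∀ n : ℕ, 0 < n → Even n →
              ∀ ε : ℝ, c' / (n : ℝ) ≤ ε → ε ≤ 1 →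
                n.choose ⌊α / ε⌋₊ ≤ nonnegRank (matchingSlack n β ε) := by
  obtain ⟨S, hS⟩ : ∃ S : ℝ, S = Fintype.card (BlockState 30) := ⟨_, rfl⟩
  have hS1 : 1 ≤ S := by rw [hS]; exact_mod_cast Fintype.card_pos
  have hβ₀ : 1 / (12 * (8 * 63 ^ 2 * 39711 ^ 2 * S)) < 1 := by
    rw [div_lt_one (by positivity)]
    linarith
  refine ⟨1 / (12 * (8 * 63 ^ 2 * 39711 ^ 2 * S)), by positivity, hβ₀, fun β hβ hβle => ?_⟩
  have hβ1 : β < 1 := hβle.trans_lt hβ₀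
  set L : ℝ := 4656 * S ^ 4 + 320 * S + 4000 with hL
  set B₀ : ℕ := ⌈Real.exp L⌉₊ with hB₀
  have hB₀1 : 1 ≤ B₀ := Nat.ceil_pos.2 (Real.exp_pos L)
  have hB₀log : ∀ B : ℕ, B₀ ≤ B → L ≤ Real.log B := by
    intro B hB
    have h1 : Real.exp L ≤ B := (Nat.le_ceil _).trans (by exact_mod_cast hB)
    exact (Real.le_log_iff_exp_le ((Real.exp_pos L).trans_le h1)).2 h1
  have hB₀1' : (1 : ℝ) ≤ B₀ := by exact_mod_cast hB₀1
  -- Here `153600 = 2 * 60 * 1280`: the array gets about `β / (60 * ε)` rows, at least `1280 * a` of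
  -- them are needed, and the factor two absorbs rounding. The value `3 * B₀` gives `180 * B₀ * K ≤
  -- n`, so each row has room for `B₀` blocks after halving `n` and removing the special elements.
  refine ⟨β / 153600, by positivity, by linarith, 3 * B₀, by positivity,
    fun n hn heven ε hεn hε1 => ?_⟩
  have hn' : (0 : ℝ) < n := by exact_mod_cast hn
  have hε : 0 < ε := lt_of_lt_of_le (by positivity) hεn
  rcases Nat.eq_zero_or_pos ⌊β / 153600 / ε⌋₊ with ha | ha
  · rw [ha, Nat.choose_zero_right]
    exact nonnegRank_matchingSlack_pos hn heven hβ hε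
  set a := ⌊β / 153600 / ε⌋₊ with ha_def
  set z : ℝ := β / ε with hz
  have hz' : β / 153600 / ε = z / 153600 := by rw [hz]; ring
  have hale : (a : ℝ) ≤ z / 153600 := by rw [← hz']; exact Nat.floor_le (by positivity)
  have ha1 : (1 : ℝ) ≤ a := by exact_mod_cast ha
  have hzbig : 153600 ≤ z := by linarith
  -- the number of rows of the array
  set K := ⌊(z - 2) / 60⌋₊ with hK
  have hK1 : (K : ℝ) ≤ (z - 2) / 60 := Nat.floor_le (by linarith)
  have hK2 : (z - 2) / 60 < K + 1 := Nat.lt_floor_add_one _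
  have hKpos : 0 < K := Nat.floor_pos.2 (by linarith)
  have haK : 1280 * a ≤ K := by
    have : 1280 * (a : ℝ) ≤ K := by linarith
    exact_mod_cast this
  -- the number of blocks in a row
  obtain ⟨h, hh⟩ := heven
  have hnK : 180 * B₀ * K ≤ n := by
    have h1 : z ≤ 1 / ε := by rw [hz]; gcongr
    have h2 : 3 * B₀ * (1 / ε) ≤ n := by
      rw [div_le_iff₀ hn'] at hεn
      rw [mul_one_div, div_le_iff₀ hε]
      linarith
    have h3 : (60 * K : ℝ) ≤ 1 / ε := by linarith
    have h4 : 3 * (B₀ : ℝ) * (60 * K) ≤ 3 * B₀ * (1 / ε) := by gcongr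
    have h5 : ((180 * B₀ * K : ℕ) : ℝ) ≤ n := by push_cast; linarith
    exact_mod_cast h5
  have hBK : 1 ≤ B₀ * K := Nat.mul_pos hB₀1 hKpos
  have hh3 : 3 ≤ h := by
    have e2 : 180 * B₀ * K = 180 * (B₀ * K) := by ring
    omega
  set B := (h - 3) / (60 * K) with hB
  have hBge : B₀ ≤ B := by
    rw [hB, Nat.le_div_iff_mul_le (by omega)]
    have e1 : B₀ * (60 * K) = 60 * (B₀ * K) := by ring
    have e2 : 180 * B₀ * K = 180 * (B₀ * K) := by ring
    omega
  have hB1 : 60 * K * B ≤ h - 3 := Nat.mul_div_le _ _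
  have hB2 : h - 3 < 60 * K * B + 60 * K := by
    have := Nat.lt_mul_div_succ (h - 3) (show 0 < 60 * K by omega)
    rw [mul_add, mul_one] at this
    exact this
  have hKB : K ≤ K * B := Nat.le_mul_of_pos_right _ (by omega)
  have e3 : 60 * K * B = 60 * (K * B) := by ring
  have hlog := hB₀log B hBge
  have hrank := exp_le_nonnegRank (K := K) (B := B) (r := h - 3 - 60 * K * B) (ε := ε) hS
    hKpos (by omega) (show n = 2 * (3 + 60 * K * B + (h - 3 - 60 * K * B)) by omega) hβ hβle (by push_cast; linarith) (by linarith)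
  have hchoose := choose_le_exp (n := n) (B := B) hKpos
    (by have := pow_pos (lt_of_lt_of_le one_pos hS1) 4; linarith)
    (by omega) haK
  exact_mod_cast hchoose.trans hrank
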